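/- **Setting.** Let $\mathbb L=\mathbb R^{2,1}$ with $\langle x,y\rangle=x_1y_1+x_2y_2-x_3y_3$ and $|x|^2=\langle x,x\rangle$. An oriented sphere has a center $m$, a signed radius $R$ and the points $\{|x-m|^2=R^2\}$; it is timelike if $R\neq0$ and a null-sphere if $R=0$. It is in oriented contact with an oriented isotropic line if it contains the line and the signed Euclidean distance of the projected center from the projected oriented line is $R$ (projection along the third coordinate to $\mathbb R^2=\mathbb C$). Colour $\mathbb Z^2$ so that $v$ is black if $v_1+v_2$ is even and white if it is odd. Nets live on $\mathbb Z^2$, or more generally on a product of two integer intervals of faces together with the incident vertices. A *null congruence* $c$ consists of oriented timelike spheres at white vertices, null-spheres at black vertices and oriented isotropic lines at faces, in oriented contact whenever vertex and face are incident. It projects to an *incircular net* (s-embedding): the circles $p(w)$ have the projected centers and the radii of the white spheres, the points $p(b)$ are the projected apices of the null-spheres, and the lines are the projected lines. The (Ising) *$X$-variable* at a white vertex $w$ is $$X(w)=-\frac{(p(b_1)-m(w))(p(b_3)-m(w))}{(p(b_2)-m(w))(p(b_4)-m(w))},$$ where $m(w)$ is the center of the circle at $w$, and $b_1=w+(1,0),b_2,b_3,b_4$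 are the neighbours of $w$ in counterclockwise order. A null congruence is *isothermic* if the white centers around each black vertex lie in a spacelike plane and neighbouring white centers are distinct. An *S-isothermic net* $h$ consists of oriented timelike spheres at white vertices, spacelike circles at black vertices and points $h(f)$ at faces, such that at each face the two spheres are in oriented contact at $h(f)$ and the two circles intersect them orthogonally at $h(f)$. It corresponds to the isothermic congruence $c$ if both have the same white spheres. Its *Christoffel dual* $h^*$ is the S-isothermic net with $\hat h^*(v)-h^*(f)=\pm\,(\hat h(v)-h(f))/|\hat h(v)-h(f)|^2$ for incident $v,f$, where $\hat h(v)$ is the center of the sphere or circle at $v$, with sign $+$ if the edge $vf$ is parallel to $(1,1)$ and $-$ if it is parallel to $(1,-1)$, and with sphere radii $R^*=R^{-1}$. A net is *Koebe* if all its circles lie in $\{|x|^2=-1,\ x_3>0\}$. The congruence $c$ is *maximal* if it is isothermic and the Christoffel dual of its S-isothermic net is Koebe. *Associated family.* Let $k$ be the Koebe net dual to the maximal congruence $c$. At a face $f$ let $N=k(f)$, let $T$ be the common oriented unit normal of the two spheres at $N$, and let $B=N\times T$ (Lorentz cross product, $\langle x\times y,z\rangle=\det(x,y,z)$). Let $T^\varphi=T\cos\varphi+B\sin\varphi$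 and $B^\varphi=-T\sin\varphi+B\cos\varphi$ be their rotations by the angle $\varphi$ around the axis $\mathbb RN$. Centers $P^\varphi$ at white vertices are integrated from $P^\varphi(w')-P^\varphi(w)=\pm(R(w)^{-1}-R(w')^{-1})\,T^\varphi$ (signed radii $R$ of $k$, with the above sign of the edge $wf$), and the contact points are $K^\varphi(f)=P^\varphi(w)\pm R(w)^{-1}T^\varphi$. For $\sigma\in\{1,-1\}$ the associated congruence $c^{\varphi}_\sigma$ has white spheres with center $P^\varphi(w)$ and radius $R(w)^{-1}$, isotropic lines through $K^\varphi(f)$ with direction $N+\sigma B^\varphi$, and black spheres in oriented contact with these lines. The associated null congruence $\dot c^{\varphi}_\sigma$ is a null congruence with the same sphere centers and with all radii decreased by $\sigma\sin\varphi$. **Theorem.** Let $c$ be a maximal congruence. 1. $c$ belongs to its own associated family: $c=\dot c^{\,0}_\sigma$ for some $\sigma\in\{1,-1\}$ (for a suitable translation). 2. For each $\sigma\in\{1,-1\}$ and each angle $\varphi$ such that no white sphere of $c$ has oriented radius $\sigma\sin\varphi$, there is an associated null congruence $\dot c^{\varphi}_\sigma$. (No angle is excluded if all white spheres of $c$ have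 radii of absolute value greater than $1$, that is, if the white spheres of $k$ intersect the unit sphere $\{|x|^2=-1\}$ in spacelike circles.) 3. The $X$-variables of all associated null congruences $\dot c^{\varphi}_\sigma$, equivalently of the incircular nets they project to, equal those of $c$ at every white vertex whose four faces belong to the domain. In particular they do not depend on $\varphi$ (nor on $\sigma$). So each maximal s-embedding comes with a pair of one-parameter families of s-embeddings that all define the same Ising model. -/

import Mathlib

/-! ### Lorentz space -/

/-- Lorentz space of signature (2,1). -/
abbrev LorentzSpace : Type := Fin 3 → ℝ

/-- The Lorentz inner product. -/
def lorentzInner (x y : LorentzSpace) : ℝ := x 0 * y 0 + x 1 * y 1 - x 2 * y 2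

/-- The quadratic form of the Lorentz inner product. -/
def lorentzSq (x : LorentzSpace) : ℝ := lorentzInner x x

/-- The Lorentz cross product, characterised by `lorentzInner (x × y) z = det (x, y, z)`. -/
def lorentzCross (x y : LorentzSpace) : LorentzSpace :=
  ![x 1 * y 2 - x 2 * y 1, x 2 * y 0 - x 0 * y 2, -(x 0 * y 1 - x 1 * y 0)]

/-- The rotation by the angle `φ` around the timelike axis spanned by `N`,
where `lorentzSq N = -1`. -/
noncomputable def lorentzRotation (φ : ℝ) (N v : LorentzSpace) : LorentzSpace :=
  Real.cos φ • v - ((1 - Real.cos φ) * lorentzInner v N) • N + Real.sin φ • lorentzCross N v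

/-- The orthogonal projection to the Euclidean plane, identified with `ℂ`. -/
def toPlane (x : LorentzSpace) : ℂ := ⟨x 0, x 1⟩

/-- The upper half of the spacelike unit sphere. -/
def upperUnitSphere : Set LorentzSpace := {x | lorentzSq x = -1 ∧ 0 < x 2}

/-- An oriented Lorentz sphere; the sign of the radius encodes the orientation.
It is timelike if `radius ≠ 0`, and a null-sphere (with apex `center`) if `radius = 0`. -/
structure OrientedSphere where
  center : LorentzSpace
  radius : ℝ

/-- The points of a sphere. -/
def OrientedSphere.points (S : OrientedSphere) : Set LorentzSpace :=
  {x | lorentzSq (x - S.center) = S.radius ^ 2}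

/-- The oriented unit normal of a timelike sphere at one of its points. -/
noncomputable def OrientedSphere.normal (S : OrientedSphere) (x : LorentzSpace) : LorentzSpace :=
  S.radius⁻¹ • (x - S.center)

/-- Two timelike spheres are in oriented contact at the point `K`. -/
def OrientedSphere.ContactAt (S S' : OrientedSphere) (K : LorentzSpace) : Prop :=
  K ∈ S.points ∧ K ∈ S'.points ∧ S.normal K = S'.normal K

/-- An oriented isotropic (lightlike) line; its direction is normalised by the requirement that
its projection to the Euclidean plane is a unit vector. -/
structure OrientedIsotropicLine where
  points : Set LorentzSpace
  dir : LorentzSpace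
  dir_isotropic : lorentzSq dir = 0
  dir_unit : ‖toPlane dir‖ = 1
  points_eq : ∃ p, points = {x | ∃ t : ℝ, x = p + t • dir}

/-- Oriented contact of a sphere and an isotropic line: the line lies in the sphere, and the
signed distance of the center from the line, as seen in the Euclidean plane, is the signed
radius. For a null-sphere this just means that the line lies in the sphere. -/
def OrientedSphere.ContactLine (S : OrientedSphere) (L : OrientedIsotropicLine) : Prop :=
  L.points ⊆ S.points ∧
    ∀ p ∈ L.points, (star (toPlane L.dir) * (toPlane S.center - toPlane p)).im = S.radius

/-- A spacelike circle: the points of the spacelike plane through `center` with timelike unit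
normal `normal` that have distance `radius` from `center`. -/
structure SpacelikeCircle where
  center : LorentzSpace
  normal : LorentzSpace
  radius : ℝ
  normal_sq : lorentzSq normal = -1
  normal_up : 0 < normal 2
  radius_pos : 0 < radius

/-- The points of a circle. -/
def SpacelikeCircle.points (C : SpacelikeCircle) : Set LorentzSpace :=
  {x | lorentzInner (x - C.center) C.normal = 0 ∧ lorentzSq (x - C.center) = C.radius ^ 2}

/-- The circle `C` intersects the timelike sphere `S` orthogonally in the point `K`: the sphere
normal at `K` lies in the plane of the circle and is orthogonal to the radius vector, that is, it
is tangent to the circle. -/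
def SpacelikeCircle.OrthogonalAt (C : SpacelikeCircle) (S : OrientedSphere) (K : LorentzSpace) :
    Prop :=
  K ∈ C.points ∧ K ∈ S.points ∧ lorentzInner (S.normal K) C.normal = 0 ∧
    lorentzInner (S.normal K) (K - C.center) = 0

/-! ### The square lattice

The face with lower left corner `f` is denoted by `f` itself. A net is defined on a set `D` of
faces of the square lattice together with all incident vertices; `D = Set.univ` is the whole
lattice. Maps are defined on all of `ℤ × ℤ`, but only their values on `D` matter. -/

/-- The vertex `v` is a corner of the face `f`. -/
def Incident (v f : ℤ × ℤ) : Prop :=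
  (v.1 = f.1 ∨ v.1 = f.1 + 1) ∧ (v.2 = f.2 ∨ v.2 = f.2 + 1)

/-- Black vertices. -/
def IsBlack (v : ℤ × ℤ) : Prop := Even (v.1 + v.2)

/-- White vertices. -/
def IsWhite (v : ℤ × ℤ) : Prop := Odd (v.1 + v.2)

/-- `v` is a vertex of the domain `D`. -/
def IsVertex (D : Set (ℤ × ℤ)) (v : ℤ × ℤ) : Prop := ∃ f ∈ D, Incident v f

/-- All four faces at `v` belong to the domain `D`. -/
def IsInterior (D : Set (ℤ × ℤ)) (v : ℤ × ℤ) : Prop := ∀ f, Incident v f → f ∈ D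

/-- The sign of the edge between the vertex `v` and the incident face `f` in the square lattice
with vertex set `V(ℤ²) ∪ F(ℤ²)`. It is `+` on the edges parallel to `(1, 1)` ("horizontal" ones)
and `-` on the edges parallel to `(1, -1)` ("vertical" ones). -/
def edgeSign (v f : ℤ × ℤ) : ℝ := if v.1 - f.1 = v.2 - f.2 then 1 else -1

/-! ### Incircular nets and their X-variables -/

/-- An oriented circle in the Euclidean plane (the radius is signed). -/
structure OrientedCircle where
  center : ℂ
  radius : ℝ
  radius_ne : radius ≠ 0

/-- An oriented line in the Euclidean plane. -/
structure OrientedLine where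
  points : Set ℂ
  dir : ℂ
  dir_unit : ‖dir‖ = 1
  points_eq : ∃ p, points = {z | ∃ t : ℝ, z = p + t • dir}

/-- Oriented contact of an oriented circle and an oriented line in the plane. -/
def OrientedCircle.ContactLine (C : OrientedCircle) (L : OrientedLine) : Prop :=
  ∀ p ∈ L.points, (star L.dir * (C.center - p)).im = C.radius

/-- An incircular net (s-embedding) on the domain `D`. -/
structure IncircularNet (D : Set (ℤ × ℤ)) where
  circle : {w // IsVertex D w ∧ IsWhite w} → OrientedCircle
  point : {b // IsVertex D b ∧ IsBlack b} → ℂ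
  line : D → OrientedLine
  white_contact : ∀ w f, Incident w.1 f.1 → (circle w).ContactLine (line f)
  black_contact : ∀ b f, Incident b.1 f.1 → point b ∈ (line f).points

theorem IsInterior.white {D : Set (ℤ × ℤ)} {w : ℤ × ℤ} (hD : IsInterior D w) (hw : IsWhite w) :
    IsVertex D w ∧ IsWhite w :=
  ⟨⟨w, hD w ⟨Or.inl rfl, Or.inl rfl⟩, ⟨Or.inl rfl, Or.inl rfl⟩⟩, hw⟩

theorem IsInterior.east {D : Set (ℤ × ℤ)} {w : ℤ × ℤ} (hD : IsInterior D w) (hw : IsWhite w) :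
    IsVertex D (w.1 + 1, w.2) ∧ IsBlack (w.1 + 1, w.2) := by
  refine ⟨⟨w, hD w ⟨Or.inl rfl, Or.inl rfl⟩, ⟨Or.inr rfl, Or.inl rfl⟩⟩, ?_⟩
  unfold IsWhite at hw; unfold IsBlack; grind

theorem IsInterior.north {D : Set (ℤ × ℤ)} {w : ℤ × ℤ} (hD : IsInterior D w) (hw : IsWhite w) :
    IsVertex D (w.1, w.2 + 1) ∧ IsBlack (w.1, w.2 + 1) := by
  refine ⟨⟨w, hD w ⟨Or.inl rfl, Or.inl rfl⟩, ⟨Or.inl rfl, Or.inr rfl⟩⟩, ?_⟩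
  unfold IsWhite at hw; unfold IsBlack; grind

theorem IsInterior.west {D : Set (ℤ × ℤ)} {w : ℤ × ℤ} (hD : IsInterior D w) (hw : IsWhite w) :
    IsVertex D (w.1 - 1, w.2) ∧ IsBlack (w.1 - 1, w.2) := by
  refine ⟨⟨(w.1 - 1, w.2), hD _ ⟨Or.inr (by simp), Or.inl rfl⟩, ⟨Or.inl rfl, Or.inl rfl⟩⟩, ?_⟩
  unfold IsWhite at hw; unfold IsBlack; grind

theorem IsInterior.south {D : Set (ℤ × ℤ)} {w : ℤ × ℤ} (hD : IsInterior D w) (hw : IsWhite w) :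
    IsVertex D (w.1, w.2 - 1) ∧ IsBlack (w.1, w.2 - 1) := by
  refine ⟨⟨(w.1, w.2 - 1), hD _ ⟨Or.inl rfl, Or.inr (by simp)⟩, ⟨Or.inl rfl, Or.inl rfl⟩⟩, ?_⟩
  unfold IsWhite at hw; unfold IsBlack; grind

/-- The (Ising) X-variable of an incircular net at a white vertex `w` all of whose four faces
belong to the domain. The neighbours of `w` in counterclockwise order, starting with
`w + (1, 0)`, are `b₁, b₂, b₃, b₄`. -/
noncomputable def IncircularNet.xVar {D : Set (ℤ × ℤ)} (p : IncircularNet D) (w : ℤ × ℤ)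
    (hw : IsWhite w) (hD : IsInterior D w) : ℂ :=
  let c := (p.circle ⟨w, hD.white hw⟩).center
  let b₁ := p.point ⟨(w.1 + 1, w.2), hD.east hw⟩
  let b₂ := p.point ⟨(w.1, w.2 + 1), hD.north hw⟩
  let b₃ := p.point ⟨(w.1 - 1, w.2), hD.west hw⟩
  let b₄ := p.point ⟨(w.1, w.2 - 1), hD.south hw⟩;
  -(((b₁ - c) * (b₃ - c)) / ((b₂ - c) * (b₄ - c)))

/-! ### Contact congruences and null congruences -/

/-- A contact congruence on the domain `D`. -/
structure ContactCongruence (D : Set (ℤ × ℤ)) where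
  sphere : ℤ × ℤ → OrientedSphere
  line : ℤ × ℤ → OrientedIsotropicLine
  contact : ∀ f ∈ D, ∀ v, Incident v f → (sphere v).ContactLine (line f)

/-- A null congruence on the domain `D`: null-spheres at the black vertices and oriented timelike
spheres at the white vertices. -/
structure NullCongruence (D : Set (ℤ × ℤ)) extends ContactCongruence D where
  black_null : ∀ b, IsVertex D b → IsBlack b → (sphere b).radius = 0
  white_timelike : ∀ w, IsVertex D w → IsWhite w → (sphere w).radius ≠ 0

/-- The orthogonal projection of an oriented isotropic line to the Euclidean plane. -/
def OrientedIsotropicLine.project (L : OrientedIsotropicLine) : OrientedLine where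
  points := toPlane '' L.points
  dir := toPlane L.dir
  dir_unit := L.dir_unit
  points_eq := by
    obtain ⟨p, hp⟩ := L.points_eq
    have key : ∀ t : ℝ, toPlane (p + t • L.dir) = toPlane p + t • toPlane L.dir := by
      intro t
      apply Complex.ext <;> simp [toPlane]
    refine ⟨toPlane p, ?_⟩
    ext z
    constructor
    · rintro ⟨x, hx, rfl⟩
      rw [hp] at hx
      obtain ⟨t, rfl⟩ := hx
      exact ⟨t, key t⟩
    · rintro ⟨t, rfl⟩
      exact ⟨p + t • L.dir, by rw [hp]; exact ⟨t, rfl⟩, key t⟩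

theorem mem_of_nullSphere_contact {S : OrientedSphere} {L : OrientedIsotropicLine}
    (h : S.ContactLine L) (h0 : S.radius = 0) : toPlane S.center ∈ L.project.points := by
  obtain ⟨p, hp⟩ := L.points_eq
  have hpL : p ∈ L.points := by rw [hp]; exact ⟨0, by simp⟩
  have him := h.2 p hpL
  rw [h0] at him
  have hunit : L.dir 0 ^ 2 + L.dir 1 ^ 2 = 1 := by
    have h1 := L.dir_unit
    have h2 := Complex.normSq_eq_norm_sq (toPlane L.dir)
    rw [h1] at h2
    simp [Complex.normSq_apply, toPlane] at h2
    nlinarith [h2]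
  simp [toPlane] at him
  refine ⟨p + ((S.center 0 - p 0) * L.dir 0 + (S.center 1 - p 1) * L.dir 1) • L.dir,
    by rw [hp]; exact ⟨_, rfl⟩, ?_⟩
  apply Complex.ext <;> simp [toPlane]
  · linear_combination (S.center 0 - p 0) * hunit + L.dir 1 * him
  · linear_combination (S.center 1 - p 1) * hunit - L.dir 0 * him

/-- The incircular net defined by a null congruence: circles are the projected contours of the
timelike spheres, points the projected apices of the null-spheres, lines the projected isotropic
lines. -/
def NullCongruence.project {D : Set (ℤ × ℤ)} (c : NullCongruence D) : IncircularNet D where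
  circle w := ⟨toPlane (c.sphere w.1).center, (c.sphere w.1).radius,
    c.white_timelike w.1 w.2.1 w.2.2⟩
  point b := toPlane (c.sphere b.1).center
  line f := (c.line f.1).project
  white_contact := by
    rintro w f hf z ⟨p, hp, rfl⟩
    exact (c.contact f.1 f.2 w.1 hf).2 p hp
  black_contact := fun b f hf =>
    mem_of_nullSphere_contact (c.contact f.1 f.2 b.1 hf) (c.black_null b.1 b.2.1 b.2.2)

/-- The X-variables of (the incircular net of) a null congruence. -/
noncomputable def NullCongruence.xVar {D : Set (ℤ × ℤ)} (c : NullCongruence D) (w : ℤ × ℤ)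
    (hw : IsWhite w) (hD : IsInterior D w) : ℂ :=
  c.project.xVar w hw hD

/-- An isothermic congruence: the centers at the white vertices form a spacelike conjugate net,
that is, around each black vertex they lie in a common spacelike plane; neighbouring white
centers are distinct, so that the net has proper edges. -/
def NullCongruence.IsIsothermic {D : Set (ℤ × ℤ)} (c : NullCongruence D) : Prop :=
  (∀ b, IsVertex D b → IsBlack b → ∃ m n : LorentzSpace, lorentzSq n < 0 ∧
    ∀ f ∈ D, Incident b f → ∀ w, IsWhite w → Incident w f →
      lorentzInner ((c.sphere w).center - m) n = 0) ∧
  ∀ f ∈ D, ∀ w w', IsWhite w → IsWhite w' → Incident w f → Incident w' f → w ≠ w' →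
    (c.sphere w).center ≠ (c.sphere w').center

/-! ### S-isothermic nets, Christoffel duals, maximal congruences -/

/-- An S-isothermic net on the domain `D`: `sphere` gives timelike spheres at white vertices,
`circle` gives spacelike circles at black vertices, and `pt` gives the contact points at
faces. -/
structure SIsothermicNet (D : Set (ℤ × ℤ)) where
  sphere : ℤ × ℤ → OrientedSphere
  circle : ℤ × ℤ → SpacelikeCircle
  pt : ℤ × ℤ → LorentzSpace
  timelike : ∀ w, IsVertex D w → IsWhite w → (sphere w).radius ≠ 0
  touch : ∀ f ∈ D, ∀ w w', IsWhite w → IsWhite w' → Incident w f → Incident w' f →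
    (sphere w).ContactAt (sphere w') (pt f)
  orthogonal : ∀ f ∈ D, ∀ w b, IsWhite w → IsBlack b → Incident w f → Incident b f →
    (circle b).OrthogonalAt (sphere w) (pt f)

/-- The S-isothermic net `h` corresponds to the isothermic congruence `c`: they have the same
timelike spheres. -/
def SIsothermicNet.CorrespondsTo {D : Set (ℤ × ℤ)} (h : SIsothermicNet D)
    (c : NullCongruence D) : Prop :=
  ∀ w, IsVertex D w → IsWhite w → h.sphere w = c.sphere w

/-- `k` is a Christoffel dual of `h` (it is determined by `h` up to translation). The map
consisting of sphere centers, circle centers and contact points is integrated from the dual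
differential, and the dual sphere radii are the inverses of the radii. -/
def SIsothermicNet.IsChristoffelDual {D : Set (ℤ × ℤ)} (h k : SIsothermicNet D) : Prop :=
  (∀ f ∈ D, ∀ w, IsWhite w → Incident w f →
    (k.sphere w).center - k.pt f =
      (edgeSign w f / lorentzSq ((h.sphere w).center - h.pt f)) •
        ((h.sphere w).center - h.pt f)) ∧
  (∀ f ∈ D, ∀ b, IsBlack b → Incident b f →
    (k.circle b).center - k.pt f =
      (edgeSign b f / lorentzSq ((h.circle b).center - h.pt f)) •
        ((h.circle b).center - h.pt f)) ∧
  ∀ w, IsVertex D w → IsWhite w → (k.sphere w).radius = (h.sphere w).radius⁻¹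

/-- A Koebe isothermic net: all circles are contained in the upper half of the unit sphere. -/
def SIsothermicNet.IsKoebe {D : Set (ℤ × ℤ)} (k : SIsothermicNet D) : Prop :=
  ∀ b, IsVertex D b → IsBlack b → (k.circle b).points ⊆ upperUnitSphere

/-- `k` is a Koebe isothermic net that is the Christoffel dual of the S-isothermic net of the
isothermic congruence `c`; in other words, the Christoffel dual of `c` is the Koebe congruence
given by `k`. -/
def NullCongruence.HasKoebeDual {D : Set (ℤ × ℤ)} (c : NullCongruence D)
    (k : SIsothermicNet D) : Prop :=
  k.IsKoebe ∧ ∃ h : SIsothermicNet D, h.CorrespondsTo c ∧ h.IsChristoffelDual k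

/-- A maximal congruence: an isothermic congruence whose Christoffel dual is Koebe. -/
def NullCongruence.IsMaximal {D : Set (ℤ × ℤ)} (c : NullCongruence D) : Prop :=
  c.IsIsothermic ∧ ∃ k : SIsothermicNet D, c.HasKoebeDual k

/-! ### The associated family -/

/-- The rotated unit edge vector `T^φ` of the associated family of the dual of a Koebe net `k`.
Here `T = (k.sphere w).normal (k.pt f)` is the unit vector along the edge of white centers
through the face `f`, and the rotation axis joins the origin to the contact point `k.pt f`. -/
noncomputable def SIsothermicNet.assocTangent {D : Set (ℤ × ℤ)} (k : SIsothermicNet D) (φ : ℝ)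
    (w f : ℤ × ℤ) : LorentzSpace :=
  lorentzRotation φ (k.pt f) ((k.sphere w).normal (k.pt f))

/-- The rotated binormal vector `B^φ`, where `B = N × T` and `N = k.pt f`. -/
noncomputable def SIsothermicNet.assocBinormal {D : Set (ℤ × ℤ)} (k : SIsothermicNet D) (φ : ℝ)
    (w f : ℤ × ℤ) : LorentzSpace :=
  lorentzRotation φ (k.pt f) (lorentzCross (k.pt f) ((k.sphere w).normal (k.pt f)))

/-- `P` is the center net (at white vertices) of a member with angle `φ` of the associated family
of the Christoffel dual of the Koebe net `k`: it integrates the associated dual differential.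
Radii are signed, so two spheres that touch from outside have radii of opposite signs, and the
difference of the inverse radii below is the sum of the inverse absolute radii up to the sign that
turns `T` into the unit vector pointing from `w` to `w'`. -/
def SIsothermicNet.IsAssocCenterNet {D : Set (ℤ × ℤ)} (k : SIsothermicNet D) (φ : ℝ)
    (P : ℤ × ℤ → LorentzSpace) : Prop :=
  ∀ f ∈ D, ∀ w w', IsWhite w → IsWhite w' → Incident w f → Incident w' f →
    P w' - P w =
      (edgeSign w f * ((k.sphere w).radius⁻¹ - (k.sphere w').radius⁻¹)) • k.assocTangent φ w f

/-- The contact point at the face `f`, seen from the white vertex `w`, of the member with center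
net `P` of the associated family. -/
noncomputable def SIsothermicNet.assocPt {D : Set (ℤ × ℤ)} (k : SIsothermicNet D) (φ : ℝ)
    (P : ℤ × ℤ → LorentzSpace) (w f : ℤ × ℤ) : LorentzSpace :=
  P w + (edgeSign w f * (k.sphere w).radius⁻¹) • k.assocTangent φ w f

/-- `g` is the associated (contact) congruence number `σ = ±1` with angle `φ`. Its spheres at white
vertices have the centers of a member of the associated family and the dual radii; its isotropic
line at a face passes through the contact point with direction `N + σ B^φ`.

The unit edge vectors `T` are the common oriented sphere normals. They run alternately with and
against the boundary orientation of the quad around a black vertex, hence the same `σ` for all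
faces means alternating signs with respect to the boundary orientation. -/
def SIsothermicNet.IsAssocCongruence {D : Set (ℤ × ℤ)} (k : SIsothermicNet D) (σ : ℤˣ) (φ : ℝ)
    (g : ContactCongruence D) : Prop :=
  ∃ P : ℤ × ℤ → LorentzSpace, k.IsAssocCenterNet φ P ∧
    (∀ w, IsVertex D w → IsWhite w → g.sphere w = ⟨P w, (k.sphere w).radius⁻¹⟩) ∧
    ∀ f ∈ D, ∀ w, IsWhite w → Incident w f →
      k.assocPt φ P w f ∈ (g.line f).points ∧
      ∃ t : ℝ, (g.line f).dir = t • (k.pt f + ((σ : ℤ) : ℝ) • k.assocBinormal φ w f)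

/-- `c` is the null congruence obtained from the associated congruence number `σ = ±1` with angle
`φ`: it has the same sphere centers, and all oriented radii are decreased by the oriented radius
`σ sin φ` of the spheres at the black vertices. -/
def SIsothermicNet.IsAssocNullCongruence {D : Set (ℤ × ℤ)} (k : SIsothermicNet D) (σ : ℤˣ) (φ : ℝ)
    (c : NullCongruence D) : Prop :=
  ∃ g : ContactCongruence D, k.IsAssocCongruence σ φ g ∧
    ∀ v, IsVertex D v →
      (c.sphere v).center = (g.sphere v).center ∧
      (c.sphere v).radius = (g.sphere v).radius - ((σ : ℤ) : ℝ) * Real.sin φ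

/-! ### Algebra of the Lorentz inner product and cross product -/

/-! At a face and an incident edge of the Koebe net, let `N` be the contact point, `T` the sphere
normal, `M`, `R` the sphere center and radius, and `C`, `r` the circle center and radius. The
vectors `N`, `T`, `B = N × T` form a Lorentz orthonormal frame, `N · M = -1`, and `C = (1 + r²) N +
δ B` with `δ² = r² (1 + r²)`. All metric facts follow from these relations.

Existence. Rotating the edges of the dual net about `N` gives a one-form with a cosine part (the
Christoffel dual itself) and a sine part (the edges `N × M / R²` and `N × C / r²`, up to sign). Both
parts are closed because two neighbouring contact points form a kite with `M` and `C`. At black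
vertices a multiple of `C` is added; it takes the same value at both faces of a shared edge, so
closedness survives (`KoebeCorner.IsKite.closed`). The form integrates over a product of intervals.
The line with direction `N + σ B^φ` then touches the white spheres of radius `1/R` and black spheres
of the constant radius `σ sin φ` (`contactLine_sphere`, `contactLine_circle`), and subtracting this
constant from all radii gives a null congruence.

Angle zero. Contact with two distinct white spheres forces the line of `c` at a face through the
contact point, with direction proportional to `N ± B`. The null-sphere at a black vertex forces the
same sign on neighbouring faces (`HasSign.eq_of_sharedEdge`).

X-variables. Black points are intersections of tangents to the circle at `w`, so `X` is a
cross-ratio-like expression in the tangent directions `d₁, …, d₄`. The squares of `dᵢ ± dⱼ` are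
governed by Lorentz products of isotropic directions, which equal `|N - N'|²` times a factor common
to all contact points of the sphere (`inner_isotropic_isotropic`). That factor carries all
dependence on `φ` and `σ`, and it cancels (`crossRatio_eq`). -/

theorem lorentzInner_comm (x y : LorentzSpace) : lorentzInner x y = lorentzInner y x := by
  simp only [lorentzInner]; ring

theorem lorentzInner_add_left (x y z : LorentzSpace) :
    lorentzInner (x + y) z = lorentzInner x z + lorentzInner y z := by
  simp only [lorentzInner, Pi.add_apply]; ring

theorem lorentzInner_sub_left (x y z : LorentzSpace) :
    lorentzInner (x - y) z = lorentzInner x z - lorentzInner y z := by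
  simp only [lorentzInner, Pi.sub_apply]; ring

theorem lorentzInner_smul_left (a : ℝ) (x y : LorentzSpace) :
    lorentzInner (a • x) y = a * lorentzInner x y := by
  simp only [lorentzInner, Pi.smul_apply, smul_eq_mul]; ring

theorem lorentzInner_add_right (x y z : LorentzSpace) :
    lorentzInner x (y + z) = lorentzInner x y + lorentzInner x z := by
  simp only [lorentzInner, Pi.add_apply]; ring

theorem lorentzInner_sub_right (x y z : LorentzSpace) :
    lorentzInner x (y - z) = lorentzInner x y - lorentzInner x z := by
  simp only [lorentzInner, Pi.sub_apply]; ring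

theorem lorentzInner_smul_right (a : ℝ) (x y : LorentzSpace) :
    lorentzInner x (a • y) = a * lorentzInner x y := by
  simp only [lorentzInner, Pi.smul_apply, smul_eq_mul]; ring

theorem lorentzCross_add_left (x y z : LorentzSpace) :
    lorentzCross (x + y) z = lorentzCross x z + lorentzCross y z := by
  ext i; fin_cases i <;> simp [lorentzCross] <;> ring

theorem lorentzCross_add_right (x y z : LorentzSpace) :
    lorentzCross x (y + z) = lorentzCross x y + lorentzCross x z := by
  ext i; fin_cases i <;> simp [lorentzCross] <;> ring

theorem lorentzCross_sub_right (x y z : LorentzSpace) :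
    lorentzCross x (y - z) = lorentzCross x y - lorentzCross x z := by
  ext i; fin_cases i <;> simp [lorentzCross] <;> ring

theorem lorentzCross_smul_left (a : ℝ) (x y : LorentzSpace) :
    lorentzCross (a • x) y = a • lorentzCross x y := by
  ext i; fin_cases i <;> simp [lorentzCross] <;> ring

theorem lorentzCross_smul_right (a : ℝ) (x y : LorentzSpace) :
    lorentzCross x (a • y) = a • lorentzCross x y := by
  ext i; fin_cases i <;> simp [lorentzCross] <;> ring

theorem lorentzCross_self (x : LorentzSpace) : lorentzCross x x = 0 := by
  ext i; fin_cases i <;> simp [lorentzCross] <;> ring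

theorem lorentzCross_anticomm (x y : LorentzSpace) : lorentzCross x y = -lorentzCross y x := by
  ext i; fin_cases i <;> simp [lorentzCross] <;> ring

theorem lorentzCross_cross (x y z : LorentzSpace) :
    lorentzCross x (lorentzCross y z) = lorentzInner x y • z - lorentzInner x z • y := by
  ext i; fin_cases i <;> simp [lorentzCross, lorentzInner] <;> ring

theorem lorentzInner_cross_left_self (x y : LorentzSpace) :
    lorentzInner x (lorentzCross x y) = 0 := by
  simp [lorentzCross, lorentzInner]; ring

theorem lorentzInner_cross_right_self (x y : LorentzSpace) :
    lorentzInner y (lorentzCross x y) = 0 := by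
  simp [lorentzCross, lorentzInner]; ring

theorem lorentzInner_cross_cross (x y z t : LorentzSpace) :
    lorentzInner (lorentzCross x y) (lorentzCross z t) =
      lorentzInner x t * lorentzInner y z - lorentzInner x z * lorentzInner y t := by
  simp [lorentzCross, lorentzInner]; ring

/-- Cramer's rule in dimension three; it yields the frame expansion `IsFrame.expand`. -/
theorem lorentzCross_cramer (x y z u : LorentzSpace) :
    lorentzInner (lorentzCross x y) z • u =
      lorentzInner u (lorentzCross y z) • x - lorentzInner u (lorentzCross x z) • y +
        lorentzInner u (lorentzCross x y) • z := by
  ext i; fin_cases i <;> simp [lorentzCross, lorentzInner] <;> ring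

/-- `N` and `T` are the first two vectors of a Lorentz orthonormal frame `N, T, N × T` with
timelike `N`. -/
structure IsFrame (N T : LorentzSpace) : Prop where
  timelike : lorentzInner N N = -1
  unit : lorentzInner T T = 1
  orthogonal : lorentzInner N T = 0

namespace IsFrame

variable {N T : LorentzSpace}

theorem cross_binormal (h : IsFrame N T) : lorentzCross N (lorentzCross N T) = -T := by
  rw [lorentzCross_cross, h.timelike, h.orthogonal]; module

theorem tangent_cross_binormal (h : IsFrame N T) : lorentzCross T (lorentzCross N T) = -N := by
  rw [lorentzCross_cross, lorentzInner_comm T N, h.unit, h.orthogonal]; module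

theorem inner_binormal_self (h : IsFrame N T) :
    lorentzInner (lorentzCross N T) (lorentzCross N T) = 1 := by
  rw [lorentzInner_cross_cross, lorentzInner_comm T N, h.timelike, h.unit, h.orthogonal]; ring

theorem expand (h : IsFrame N T) (x : LorentzSpace) :
    x = -lorentzInner x N • N + lorentzInner x T • T +
      lorentzInner x (lorentzCross N T) • lorentzCross N T := by
  have key := lorentzCross_cramer N T (lorentzCross N T) x
  rw [h.inner_binormal_self, h.tangent_cross_binormal, h.cross_binormal,
    ← neg_one_smul ℝ N, ← neg_one_smul ℝ T, lorentzInner_smul_right,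
    lorentzInner_smul_right] at key
  linear_combination (norm := module) key

theorem rotation_tangent (h : IsFrame N T) (φ : ℝ) :
    lorentzRotation φ N T = Real.cos φ • T + Real.sin φ • lorentzCross N T := by
  rw [lorentzRotation, lorentzInner_comm, h.orthogonal]; module

theorem rotation_binormal (h : IsFrame N T) (φ : ℝ) :
    lorentzRotation φ N (lorentzCross N T) =
      Real.cos φ • lorentzCross N T - Real.sin φ • T := by
  rw [lorentzRotation, lorentzInner_comm, lorentzInner_cross_left_self, h.cross_binormal]; module

/-- The rotated frame is a frame. -/
theorem rotation (h : IsFrame N T) (φ : ℝ) : IsFrame N (lorentzRotation φ N T) := by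
  refine ⟨h.timelike, ?_, ?_⟩ <;> rw [h.rotation_tangent]
  · simp only [lorentzInner_add_left, lorentzInner_add_right, lorentzInner_smul_left,
      lorentzInner_smul_right, h.unit, h.inner_binormal_self, lorentzInner_cross_right_self,
      lorentzInner_comm (lorentzCross N T) T]
    linear_combination Real.sin_sq_add_cos_sq φ
  · simp only [lorentzInner_add_right, lorentzInner_smul_right, h.orthogonal,
      lorentzInner_cross_left_self]
    ring

/-- Rotation about `N` commutes with `N × ·`. Hence `B^φ` is the binormal of the frame `N, T^φ`, and
facts proved for one frame apply at every angle. -/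
theorem cross_rotation_tangent (h : IsFrame N T) (φ : ℝ) :
    lorentzCross N (lorentzRotation φ N T) = lorentzRotation φ N (lorentzCross N T) := by
  rw [h.rotation_tangent, h.rotation_binormal, lorentzCross_add_right, lorentzCross_smul_right,
    lorentzCross_smul_right, h.cross_binormal]
  module

theorem inner_isotropic (h : IsFrame N T) {σ : ℝ} (hσ : σ ^ 2 = 1) :
    lorentzInner (N + σ • lorentzCross N T) (N + σ • lorentzCross N T) = 0 := by
  simp only [lorentzInner_add_left, lorentzInner_add_right, lorentzInner_smul_left,
      lorentzInner_smul_right, h.timelike, h.inner_binormal_self, lorentzInner_cross_left_self,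
      lorentzInner_comm (lorentzCross N T) N]
  linear_combination hσ

theorem isotropic_ne_zero (h : IsFrame N T) (σ : ℝ) : N + σ • lorentzCross N T ≠ 0 := by
  intro h0
  have h1 : lorentzInner N (N + σ • lorentzCross N T) = 0 := by
    rw [h0]; simp [lorentzInner]
  rw [lorentzInner_add_right, lorentzInner_smul_right, h.timelike,
    lorentzInner_cross_left_self] at h1
  linarith

/-- Isotropic vectors orthogonal to `T` are eigenvectors of the cross product with `T`. The
eigenvalue `σ` is how the choice of congruence enters the orientation of contact. -/
theorem isotropic_cross_tangent (h : IsFrame N T) {σ : ℝ} (hσ : σ ^ 2 = 1) :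
    lorentzCross (N + σ • lorentzCross N T) T = σ • (N + σ • lorentzCross N T) := by
  rw [lorentzCross_add_left, lorentzCross_smul_left, lorentzCross_anticomm (lorentzCross N T) T,
    h.tangent_cross_binormal]
  linear_combination (norm := module) (-hσ) • lorentzCross N T

/-- A vector orthogonal to the isotropic vector `D` proportional to `N + σ N × T`. -/
theorem eq_of_inner_isotropic (h : IsFrame N T) {σ t : ℝ} (hσ : σ ^ 2 = 1) (ht : t ≠ 0)
    {x : LorentzSpace} (hx : lorentzInner x (t • (N + σ • lorentzCross N T)) = 0) :
    x = lorentzInner x T • T - lorentzInner x N • (N + σ • lorentzCross N T) := by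
  rw [lorentzInner_smul_right, lorentzInner_add_right, lorentzInner_smul_right] at hx
  have hx' := (mul_eq_zero.mp hx).resolve_left ht
  have h1 : lorentzInner x (lorentzCross N T) = -σ * lorentzInner x N := by
    linear_combination σ * hx' - lorentzInner x (lorentzCross N T) * hσ
  have h2 := h.expand x
  rw [h1] at h2
  linear_combination (norm := module) h2

/-- An isotropic vector orthogonal to `T` is proportional to `N ± N × T`. -/
theorem exists_isotropic (h : IsFrame N T) {D : LorentzSpace} (hD : lorentzInner D D = 0)
    (hT : lorentzInner D T = 0) :
    ∃ (σ : ℤˣ) (t : ℝ), D = t • (N + ((σ : ℤ) : ℝ) • lorentzCross N T) := by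
  have h2 := h.expand D
  rw [hT] at h2
  have h3 : lorentzInner D (lorentzCross N T) ^ 2 = lorentzInner D N ^ 2 := by
    rw [h2] at hD
    simp only [lorentzInner_add_left, lorentzInner_add_right, lorentzInner_smul_left,
      lorentzInner_smul_right, h.timelike, h.inner_binormal_self, lorentzInner_cross_left_self,
      lorentzInner_comm (lorentzCross N T) N, h.unit, h.orthogonal, lorentzInner_comm T N] at hD
    linear_combination hD
  rcases sq_eq_sq_iff_eq_or_eq_neg.mp h3 with h4 | h4
  · refine ⟨-1, -lorentzInner D N, ?_⟩
    rw [h4] at h2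
    push_cast
    linear_combination (norm := module) h2
  · refine ⟨1, -lorentzInner D N, ?_⟩
    rw [h4] at h2
    push_cast
    linear_combination (norm := module) h2

end IsFrame

/-! ### Contact of spheres and isotropic lines -/

/-- The signed distance, in the Euclidean plane, of the vector `x` from the line spanned by `D`. -/
def planarDet (D x : LorentzSpace) : ℝ := D 0 * x 1 - D 1 * x 0

theorem planarDet_eq_cross (D x : LorentzSpace) : planarDet D x = -lorentzCross D x 2 := by
  simp [planarDet, lorentzCross]

theorem planarDet_sub (D x y : LorentzSpace) :
    planarDet D (x - y) = planarDet D x - planarDet D y := by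
  simp only [planarDet, Pi.sub_apply]; ring

theorem planarDet_add (D x y : LorentzSpace) :
    planarDet D (x + y) = planarDet D x + planarDet D y := by
  simp only [planarDet, Pi.add_apply]; ring

theorem planarDet_smul (D : LorentzSpace) (a : ℝ) (x : LorentzSpace) :
    planarDet D (a • x) = a * planarDet D x := by
  simp only [planarDet, Pi.smul_apply, smul_eq_mul]; ring

theorem planarDet_smul_left (D : LorentzSpace) (a : ℝ) (x : LorentzSpace) :
    planarDet (a • D) x = a * planarDet D x := by
  simp only [planarDet, Pi.smul_apply, smul_eq_mul]; ring

theorem planarDet_self (D : LorentzSpace) : planarDet D D = 0 := by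
  simp only [planarDet]; ring

theorem norm_toPlane_eq_one_iff (D : LorentzSpace) :
    ‖toPlane D‖ = 1 ↔ D 0 ^ 2 + D 1 ^ 2 = 1 := by
  rw [← sq_eq_sq₀ (norm_nonneg _) zero_le_one, ← Complex.normSq_eq_norm_sq, Complex.normSq_apply,
    toPlane, one_pow, ← sq, ← sq]

namespace OrientedIsotropicLine

variable (L : OrientedIsotropicLine)

theorem planar_unit : L.dir 0 ^ 2 + L.dir 1 ^ 2 = 1 :=
  (norm_toPlane_eq_one_iff _).mp L.dir_unit

theorem inner_dir : lorentzInner L.dir L.dir = 0 := L.dir_isotropic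

theorem third_sq : L.dir 2 ^ 2 = 1 := by
  have h := L.inner_dir
  have h1 := L.planar_unit
  simp only [lorentzInner] at h
  linear_combination h1 - h

theorem dir_ne_zero : L.dir ≠ 0 := by
  intro h
  have := L.planar_unit
  simp [h] at this

variable {L}

theorem mem_points_iff {p x : LorentzSpace} (hp : p ∈ L.points) :
    x ∈ L.points ↔ ∃ t : ℝ, x = p + t • L.dir := by
  obtain ⟨q, hq⟩ := L.points_eq
  rw [hq] at hp ⊢
  obtain ⟨a, rfl⟩ := hp
  constructor
  · rintro ⟨t, rfl⟩
    exact ⟨t - a, by module⟩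
  · rintro ⟨t, rfl⟩
    exact ⟨a + t, by module⟩

theorem exists_mem (L : OrientedIsotropicLine) : ∃ p, p ∈ L.points := by
  obtain ⟨q, hq⟩ := L.points_eq
  exact ⟨q, by rw [hq]; exact ⟨0, by simp⟩⟩

/-- On the orthogonal complement of an isotropic direction, the quadratic form is the square of
the planar determinant. -/
theorem inner_self_of_orthogonal {x : LorentzSpace} (hx : lorentzInner x L.dir = 0) :
    lorentzInner x x = planarDet L.dir x ^ 2 := by
  have h1 := L.planar_unit
  have h2 := L.third_sq
  simp only [lorentzInner, planarDet] at hx ⊢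
  linear_combination (-(x 0 ^ 2 + x 1 ^ 2)) * h1 + x 2 ^ 2 * h2 +
    (x 0 * L.dir 0 + x 1 * L.dir 1 + x 2 * L.dir 2) * hx

/-- The orthogonal plane of an isotropic vector is degenerate, with that vector spanning its
radical; the planar determinant is a coordinate on the quotient. -/
theorem eq_smul_of_orthogonal {x : LorentzSpace} (hx : lorentzInner x L.dir = 0)
    (hdet : planarDet L.dir x = 0) : ∃ t : ℝ, x = t • L.dir := by
  have h1 := L.planar_unit
  have h2 := L.third_sq
  simp only [lorentzInner, planarDet] at hx hdet
  refine ⟨x 0 * L.dir 0 + x 1 * L.dir 1, ?_⟩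
  ext i
  fin_cases i <;> simp
  · linear_combination (-x 0) * h1 - L.dir 1 * hdet
  · linear_combination (-x 1) * h1 + L.dir 0 * hdet
  · linear_combination (-x 2) * h2 - L.dir 2 * hx

end OrientedIsotropicLine

/-- Reduces contact to two scalar equations at a single point of the line. Both quantities are
constant along the line because `L.dir` is isotropic and has zero planar determinant with itself. -/
theorem OrientedSphere.contactLine_iff {S : OrientedSphere} {L : OrientedIsotropicLine}
    {p : LorentzSpace} (hp : p ∈ L.points) :
    S.ContactLine L ↔
      lorentzInner (S.center - p) L.dir = 0 ∧ planarDet L.dir (S.center - p) = S.radius := by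
  have him : ∀ q : LorentzSpace,
      (star (toPlane L.dir) * (toPlane S.center - toPlane q)).im =
        planarDet L.dir (S.center - q) := by
    intro q
    simp [toPlane, planarDet]; ring
  constructor
  · rintro ⟨h1, h2⟩
    refine ⟨?_, by rw [← him]; exact h2 p hp⟩
    have hp' := h1 hp
    -- A second point of the line suffices: the difference of the two sphere equations is linear in
    -- the direction.
    have hq := h1 ((OrientedIsotropicLine.mem_points_iff hp).mpr ⟨1, rfl⟩)
    simp only [OrientedSphere.points, Set.mem_ofPred_eq, lorentzSq] at hp' hq
    rw [← hp', one_smul, add_sub_right_comm] at hq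
    simp only [lorentzInner_add_left, lorentzInner_add_right, L.inner_dir,
      lorentzInner_comm L.dir] at hq
    rw [← neg_sub p, ← neg_one_smul ℝ (p - S.center), lorentzInner_smul_left]
    linarith
  · rintro ⟨h1, h2⟩
    have key : ∀ q ∈ L.points, lorentzInner (S.center - q) L.dir = 0 ∧
        planarDet L.dir (S.center - q) = S.radius := by
      intro q hq
      obtain ⟨t, rfl⟩ := (OrientedIsotropicLine.mem_points_iff hp).mp hq
      constructor
      · rw [← sub_sub, lorentzInner_sub_left, h1, lorentzInner_smul_left, L.inner_dir]; ring
      · rw [← sub_sub, planarDet_sub, h2, planarDet_smul, planarDet_self]; ring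
    refine ⟨fun q hq => ?_, fun q hq => by rw [him]; exact (key q hq).2⟩
    obtain ⟨k1, k2⟩ := key q hq
    rw [OrientedSphere.points, Set.mem_ofPred_eq, ← k2, ← L.inner_self_of_orthogonal k1, lorentzSq,
      ← neg_sub S.center, ← neg_one_smul ℝ (S.center - q), lorentzInner_smul_left,
      lorentzInner_smul_right]
    ring

/-- The isotropic line through `p` with direction proportional to a given isotropic vector, with
prescribed sign of the third coordinate of the direction. -/
theorem exists_isotropicLine (p : LorentzSpace) {E : LorentzSpace} (hE : lorentzInner E E = 0)
    (hE0 : E ≠ 0) {a : ℝ} (ha : a ^ 2 = 1) :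
    ∃ (L : OrientedIsotropicLine) (t : ℝ), p ∈ L.points ∧ L.dir = t • E ∧ L.dir 2 = a := by
  have h2 : E 2 ≠ 0 := by
    intro h2
    simp only [lorentzInner, h2] at hE
    apply hE0
    have h0 : E 0 = 0 := by nlinarith [sq_nonneg (E 0), sq_nonneg (E 1)]
    have h1 : E 1 = 0 := by nlinarith [sq_nonneg (E 0), sq_nonneg (E 1)]
    ext i
    fin_cases i <;> simp [h0, h1, h2]
  refine ⟨⟨{x | ∃ t : ℝ, x = p + t • ((a / E 2) • E)}, (a / E 2) • E, ?_, ?_, p, rfl⟩, a / E 2,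
    ⟨0, by simp⟩, rfl, by simp [h2]⟩
  · rw [lorentzSq, lorentzInner_smul_left, lorentzInner_smul_right, hE]; ring
  · rw [norm_toPlane_eq_one_iff]
    simp only [Pi.smul_apply, smul_eq_mul]
    simp only [lorentzInner] at hE
    field_simp
    linear_combination a ^ 2 * hE + E 2 ^ 2 * ha

/-- The parallel isotropic line whose signed distances in the plane are decreased by `δ`. -/
def OrientedIsotropicLine.shift (L : OrientedIsotropicLine) (δ : ℝ) : OrientedIsotropicLine where
  points := {x | x - δ • ![-L.dir 1, L.dir 0, 0] ∈ L.points}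
  dir := L.dir
  dir_isotropic := L.dir_isotropic
  dir_unit := L.dir_unit
  points_eq := by
    obtain ⟨p, hp⟩ := L.points_eq
    refine ⟨p + δ • ![-L.dir 1, L.dir 0, 0], ?_⟩
    ext x
    rw [hp]
    refine exists_congr fun t => ?_
    rw [sub_eq_iff_eq_add, add_right_comm]

theorem OrientedSphere.ContactLine.shift {S : OrientedSphere} {L : OrientedIsotropicLine}
    (h : S.ContactLine L) (δ : ℝ) :
    (OrientedSphere.mk S.center (S.radius - δ)).ContactLine (L.shift δ) := by
  obtain ⟨p, hp⟩ := L.exists_mem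
  have hp' : p + δ • ![-L.dir 1, L.dir 0, 0] ∈ (L.shift δ).points := by
    change p + _ - _ ∈ L.points
    rwa [add_sub_cancel_right]
  obtain ⟨h1, h2⟩ := (OrientedSphere.contactLine_iff hp).mp h
  have h3 := L.planar_unit
  refine (OrientedSphere.contactLine_iff hp').mpr ⟨?_, ?_⟩
  · simp only [lorentzInner, OrientedIsotropicLine.shift, Pi.sub_apply, Pi.add_apply,
      Pi.smul_apply, smul_eq_mul, Matrix.cons_val] at h1 ⊢
    linear_combination h1
  · simp only [planarDet, OrientedIsotropicLine.shift, Pi.sub_apply, Pi.add_apply,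
      Pi.smul_apply, smul_eq_mul, Matrix.cons_val] at h2 ⊢
    linear_combination h2 - δ * h3

namespace IsFrame

variable {N T : LorentzSpace}

/-- Modulo `D` the vector `x` is a multiple of `T`, and the planar determinant is minus the third
coordinate of `D × x`, where `D × T = σ D`. -/
theorem planarDet_eq (h : IsFrame N T) {σ t : ℝ} (hσ : σ ^ 2 = 1) (ht : t ≠ 0)
    {D x : LorentzSpace} (hD : D = t • (N + σ • lorentzCross N T))
    (hx : lorentzInner x D = 0) : planarDet D x = -σ * D 2 * lorentzInner x T := by
  subst hD
  rw [h.eq_of_inner_isotropic hσ ht hx, planarDet_sub, planarDet_smul, planarDet_smul,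
    planarDet_smul_left _ t (N + _), planarDet_self, ← h.eq_of_inner_isotropic hσ ht hx,
    planarDet_eq_cross, lorentzCross_smul_left, h.isotropic_cross_tangent hσ]
  simp only [Pi.smul_apply, smul_eq_mul]
  ring

end IsFrame

/-! ### Combinatorics of the square lattice -/

/-- The faces `f` and `f'` share the edge from the white vertex `w` to the black vertex `b`. -/
structure SharedEdge (f f' w b : ℤ × ℤ) : Prop where
  ne : f ≠ f'
  white : IsWhite w
  black : IsBlack b
  white_left : Incident w f
  white_right : Incident w f'
  black_left : Incident b f
  black_right : Incident b f'

theorem SharedEdge.symm {f f' w b : ℤ × ℤ} (h : SharedEdge f f' w b) : SharedEdge f' f w b :=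
  ⟨h.ne.symm, h.white, h.black, h.white_right, h.white_left, h.black_right, h.black_left⟩

theorem edgeSign_sq (v f : ℤ × ℤ) : edgeSign v f ^ 2 = 1 := by
  unfold edgeSign; split_ifs <;> norm_num

theorem edgeSign_ne_zero (v f : ℤ × ℤ) : edgeSign v f ≠ 0 := by
  unfold edgeSign; split_ifs <;> norm_num

theorem edgeSign_eq_of_white {w w' f : ℤ × ℤ} (hw : IsWhite w) (hw' : IsWhite w')
    (hf : Incident w f) (hf' : Incident w' f) : edgeSign w' f = edgeSign w f := by
  unfold IsWhite at hw hw'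
  unfold Incident at hf hf'
  unfold edgeSign
  have : w.1 - f.1 = w.2 - f.2 ↔ w'.1 - f.1 = w'.2 - f.2 := by
    rw [Int.odd_iff] at hw hw'; omega
  simp [this]

theorem edgeSign_black {w b f : ℤ × ℤ} (hw : IsWhite w) (hb : IsBlack b)
    (hwf : Incident w f) (hbf : Incident b f) : edgeSign b f = -edgeSign w f := by
  unfold IsWhite at hw
  unfold IsBlack at hb
  unfold Incident at hwf hbf
  unfold edgeSign
  have : w.1 - f.1 = w.2 - f.2 ↔ ¬ b.1 - f.1 = b.2 - f.2 := by
    rw [Int.odd_iff] at hw; rw [Int.even_iff] at hb; omega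
  by_cases h : b.1 - f.1 = b.2 - f.2 <;> simp [this, h]

theorem SharedEdge.edgeSign_right {f f' w b : ℤ × ℤ} (h : SharedEdge f f' w b) :
    edgeSign w f' = -edgeSign w f := by
  obtain ⟨h0, h1, h2, h3, h4, h5, h6⟩ := h
  obtain ⟨i, j⟩ := f
  obtain ⟨i', j'⟩ := f'
  obtain ⟨w1, w2⟩ := w
  obtain ⟨b1, b2⟩ := b
  simp only [IsWhite, IsBlack, Incident, edgeSign, ne_eq, Prod.mk.injEq, Int.odd_iff,
    Int.even_iff] at *
  have : w1 - i' = w2 - j' ↔ ¬ w1 - i = w2 - j := by omega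
  by_cases h : w1 - i = w2 - j <;> simp [this, h]

theorem exists_two_white (f : ℤ × ℤ) :
    ∃ w w', IsWhite w ∧ IsWhite w' ∧ Incident w f ∧ Incident w' f ∧ w ≠ w' := by
  obtain ⟨i, j⟩ := f
  by_cases h : (i + j) % 2 = 0
  · refine ⟨(i + 1, j), (i, j + 1), ?_⟩
    simp [IsWhite, Incident, Int.odd_iff]; omega
  · refine ⟨(i, j), (i + 1, j + 1), ?_⟩
    simp [IsWhite, Incident, Int.odd_iff]; omega

theorem exists_sharedEdge_right (i j : ℤ) : ∃ w b, SharedEdge (i, j) (i + 1, j) w b ∧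
    ((w = (i + 1, j) ∧ b = (i + 1, j + 1)) ∨ (b = (i + 1, j) ∧ w = (i + 1, j + 1))) := by
  by_cases h : (i + j) % 2 = 0
  · refine ⟨(i + 1, j), (i + 1, j + 1), ⟨?_, ?_, ?_, ?_, ?_, ?_, ?_⟩, by simp⟩ <;>
    simp [IsWhite, IsBlack, Incident, Int.odd_iff, Int.even_iff] <;> omega
  · refine ⟨(i + 1, j + 1), (i + 1, j), ⟨?_, ?_, ?_, ?_, ?_, ?_, ?_⟩, by simp⟩ <;>
    simp [IsWhite, IsBlack, Incident, Int.odd_iff, Int.even_iff] <;> omega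

theorem exists_sharedEdge_up (i j : ℤ) : ∃ w b, SharedEdge (i, j) (i, j + 1) w b ∧
    ((w = (i, j + 1) ∧ b = (i + 1, j + 1)) ∨ (b = (i, j + 1) ∧ w = (i + 1, j + 1))) := by
  by_cases h : (i + j) % 2 = 0
  · refine ⟨(i, j + 1), (i + 1, j + 1), ⟨?_, ?_, ?_, ?_, ?_, ?_, ?_⟩, by simp⟩ <;>
    simp [IsWhite, IsBlack, Incident, Int.odd_iff, Int.even_iff] <;> omega
  · refine ⟨(i + 1, j + 1), (i, j + 1), ⟨?_, ?_, ?_, ?_, ?_, ?_, ?_⟩, by simp⟩ <;>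
    simp [IsWhite, IsBlack, Incident, Int.odd_iff, Int.even_iff] <;> omega

/-- Induction along an interval of integers, in both directions. -/
theorem Set.OrdConnected.int_induction {J : Set ℤ} (hJ : J.OrdConnected) {P : ℤ → Prop} {a : ℤ}
    (ha : a ∈ J) (h0 : P a) (hstep : ∀ j, j ∈ J → j + 1 ∈ J → (P j ↔ P (j + 1))) {b : ℤ}
    (hb : b ∈ J) : P b := by
  rcases le_total a b with hab | hab
  · suffices ∀ n, a ≤ n → n ∈ J → P n from this b hab hb
    intro n hn
    induction n, hn using Int.leInduction with
    | base => exact fun _ => h0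
    | succ n hn ih =>
      intro hn1
      have hnJ : n ∈ J := hJ.out ha hn1 ⟨hn, by omega⟩
      exact (hstep n hnJ hn1).mp (ih hnJ)
  · suffices ∀ n, n ≤ a → n ∈ J → P n from this b hab hb
    intro n hn
    induction n, hn using Int.leInductionDown with
    | base => exact fun _ => h0
    | pred n hn ih =>
      intro hn1
      have hnJ : n ∈ J := hJ.out hn1 ha ⟨by omega, hn⟩
      refine (hstep (n - 1) hn1 (by simpa using hnJ)).mpr ?_
      simpa using ih hnJ

/-- Every function on the integers is a difference. -/
theorem exists_int_primitive {A : Type*} [AddCommGroup A] (g : ℤ → A) (a : ℤ) :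
    ∃ G : ℤ → A, G a = 0 ∧ ∀ n, G (n + 1) - G n = g n := by
  let H : ℤ → A := fun n =>
    ∑ i ∈ Finset.Ico 0 n, g i - ∑ i ∈ Finset.Ico n 0, g i
  have hH : ∀ n, H (n + 1) - H n = g n := by
    intro n
    rcases lt_or_ge n 0 with hn | hn
    · have e1 : Finset.Ico n 0 = insert n (Finset.Ico (n + 1) 0) := by
        ext x; simp only [Finset.mem_Ico, Finset.mem_insert]; omega
      have e2 : Finset.Ico 0 n = ∅ := Finset.Ico_eq_empty (by omega)
      have e3 : Finset.Ico 0 (n + 1) = ∅ := Finset.Ico_eq_empty (by omega)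
      simp only [H, e1, e2, e3]
      rw [Finset.sum_insert (by simp)]
      simp
    · have e1 : Finset.Ico 0 (n + 1) = insert n (Finset.Ico 0 n) := by
        ext x; simp only [Finset.mem_Ico, Finset.mem_insert]; omega
      have e2 : Finset.Ico n 0 = ∅ := Finset.Ico_eq_empty (by omega)
      have e3 : Finset.Ico (n + 1) 0 = ∅ := Finset.Ico_eq_empty (by omega)
      simp only [H, e1, e2, e3]
      rw [Finset.sum_insert (by simp)]
      simp
  exact ⟨fun n => H n - H a, sub_self _, fun n => by rw [sub_sub_sub_cancel_right, hH]⟩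

/-- A closed discrete one-form on a product of two integer intervals is exact. -/
theorem exists_face_potential {A : Type*} [AddCommGroup A] {I J : Set ℤ} (hJ : J.OrdConnected)
    (a b : ℤ → ℤ → A)
    (hab : ∀ i j, i ∈ I → i + 1 ∈ I → j ∈ J → j + 1 ∈ J →
      a i j + b (i + 1) j = b i j + a i (j + 1)) :
    ∃ K : ℤ → ℤ → A, (∀ i j, i ∈ I → i + 1 ∈ I → j ∈ J → K (i + 1) j - K i j = a i j) ∧
      ∀ i j, K i (j + 1) - K i j = b i j := by
  by_cases hne : J.Nonempty
  · obtain ⟨j0, hj0⟩ := hne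
    obtain ⟨G, -, hG⟩ := exists_int_primitive (fun i => a i j0) 0
    choose B hB0 hB using fun i => exists_int_primitive (b i) j0
    refine ⟨fun i j => G i + B i j, fun i j hi hi' hj => ?_, fun i j => ?_⟩
    -- Each column is normalised to vanish at `j0`, so the horizontal increments are right in that
    -- row; closedness carries them to the other rows.
    · refine hJ.int_induction (P := fun j => G (i + 1) + B (i + 1) j - (G i + B i j) = a i j)
        hj0 ?_ ?_ hj
      · rw [hB0, hB0, add_zero, add_zero, hG]
      · intro j hj hj'
        have h1 := hab i j hi hi' hj hj'
        rw [← hB, ← hB] at h1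
        constructor
        · intro h2
          rw [← h2] at h1
          have h3 := sub_eq_zero.mpr h1
          rw [← sub_eq_zero, ← h3]
          abel
        · intro h2
          rw [← h2] at h1
          have h3 := sub_eq_zero.mpr h1
          rw [← sub_eq_zero, ← neg_eq_zero, ← h3]
          abel
    · change G i + B i (j + 1) - (G i + B i j) = b i j
      rw [add_sub_add_left_eq_sub, hB]
  · obtain ⟨G, hG⟩ : ∃ G : ℤ → ℤ → A, ∀ i j, G i (j + 1) - G i j = b i j := by
      choose B _ hB using fun i => exists_int_primitive (b i) 0
      exact ⟨B, hB⟩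
    exact ⟨G, fun i j _ _ hj => (hne ⟨j, hj⟩).elim, hG⟩

/-- A property of faces that is invariant under passing to a face that shares an edge holds on a
whole product of two integer intervals. -/
theorem face_induction {I J : Set ℤ} (hI : I.OrdConnected) (hJ : J.OrdConnected)
    {P : ℤ × ℤ → Prop} (hstep : ∀ f ∈ I ×ˢ J, ∀ f' ∈ I ×ˢ J, ∀ w b, SharedEdge f f' w b → P f → P f')
    {f f' : ℤ × ℤ} (hf : f ∈ I ×ˢ J) (hf' : f' ∈ I ×ˢ J) (h : P f) : P f' := by
  obtain ⟨i, j⟩ := f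
  obtain ⟨i', j'⟩ := f'
  have h1 : P (i', j) := by
    refine hI.int_induction (P := fun i => P (i, j)) hf.1 h (fun n hn hn' => ?_) hf'.1
    obtain ⟨w, b, hwb, -⟩ := exists_sharedEdge_right n j
    exact ⟨hstep (n, j) ⟨hn, hf.2⟩ (n + 1, j) ⟨hn', hf.2⟩ w b hwb,
      hstep (n + 1, j) ⟨hn', hf.2⟩ (n, j) ⟨hn, hf.2⟩ w b hwb.symm⟩
  refine hJ.int_induction (P := fun j => P (i', j)) hf.2 h1 (fun n hn hn' => ?_) hf'.2
  obtain ⟨w, b, hwb, -⟩ := exists_sharedEdge_up i' n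
  exact ⟨hstep (i', n) ⟨hf'.1, hn⟩ (i', n + 1) ⟨hf'.1, hn'⟩ w b hwb,
    hstep (i', n + 1) ⟨hf'.1, hn'⟩ (i', n) ⟨hf'.1, hn⟩ w b hwb.symm⟩

/-- Integration of a one-form on the edges between vertices and faces that is closed on the
quads consisting of two adjacent faces and the ends of their common edge. -/
theorem exists_vertex_face_potential {A : Type*} [AddCommGroup A] {I J : Set ℤ}
    (hJ : J.OrdConnected) (S : ℤ × ℤ → ℤ × ℤ → A)
    (hS : ∀ f ∈ I ×ˢ J, ∀ f' ∈ I ×ˢ J, ∀ w b, SharedEdge f f' w b →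
      S w f - S w f' = S b f - S b f') :
    ∃ Z K : ℤ × ℤ → A, ∀ f ∈ I ×ˢ J, ∀ v, Incident v f → Z v = K f + S v f := by
  classical
  have hright : ∀ i j, i ∈ I → i + 1 ∈ I → j ∈ J →
      S (i + 1, j) (i, j) - S (i + 1, j) (i + 1, j) =
        S (i + 1, j + 1) (i, j) - S (i + 1, j + 1) (i + 1, j) := by
    intro i j hi hi' hj
    obtain ⟨w, b, h, ⟨rfl, rfl⟩ | ⟨rfl, rfl⟩⟩ := exists_sharedEdge_right i j
    · exact hS _ ⟨hi, hj⟩ _ ⟨hi', hj⟩ _ _ h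
    · exact (hS _ ⟨hi, hj⟩ _ ⟨hi', hj⟩ _ _ h).symm
  have hup : ∀ i j, i ∈ I → j ∈ J → j + 1 ∈ J →
      S (i, j + 1) (i, j) - S (i, j + 1) (i, j + 1) =
        S (i + 1, j + 1) (i, j) - S (i + 1, j + 1) (i, j + 1) := by
    intro i j hi hj hj'
    obtain ⟨w, b, h, ⟨rfl, rfl⟩ | ⟨rfl, rfl⟩⟩ := exists_sharedEdge_up i j
    · exact hS _ ⟨hi, hj⟩ _ ⟨hi, hj'⟩ _ _ h
    · exact (hS _ ⟨hi, hj⟩ _ ⟨hi, hj'⟩ _ _ h).symm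
  obtain ⟨K, hK1, hK2⟩ := exists_face_potential (I := I) hJ
    (fun i j => S (i + 1, j + 1) (i, j) - S (i + 1, j + 1) (i + 1, j))
    (fun i j => S (i + 1, j + 1) (i, j) - S (i + 1, j + 1) (i, j + 1)) (by
      intro i j hi hi' hj hj'
      -- Both rewrites make every increment refer to the vertex `(i + 1, j + 1)` common to the four
      -- faces; the sum around it then telescopes.
      rw [← hright i (j + 1) hi hi' hj', ← hup (i + 1) j hi' hj hj']
      abel)
  let G : ℤ × ℤ → ℤ × ℤ → A := fun v f => K f.1 f.2 + S v f
  have hGr : ∀ i j, i ∈ I → i + 1 ∈ I → j ∈ J → ∀ v, Incident v (i, j) → Incident v (i + 1, j) →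
      G v (i, j) = G v (i + 1, j) := by
    intro i j hi hi' hj v hv hv'
    have h1 := hK1 i j hi hi' hj
    have h2 := hright i j hi hi' hj
    obtain ⟨v1, v2⟩ := v
    have hv1 : v1 = i + 1 := by simp only [Incident] at hv hv'; omega
    obtain rfl | rfl : v2 = j ∨ v2 = j + 1 := hv.2
    · subst hv1
      change K _ _ + _ = K _ _ + _
      rw [← h2] at h1
      rw [← sub_eq_zero] at h1 ⊢
      rw [← neg_eq_zero, ← h1]; abel
    · subst hv1
      change K _ _ + _ = K _ _ + _
      rw [← sub_eq_zero] at h1 ⊢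
      rw [← neg_eq_zero, ← h1]; abel
  have hGu : ∀ i j, i ∈ I → j ∈ J → j + 1 ∈ J → ∀ v, Incident v (i, j) → Incident v (i, j + 1) →
      G v (i, j) = G v (i, j + 1) := by
    intro i j hi hj hj' v hv hv'
    have h1 := hK2 i j
    have h2 := hup i j hi hj hj'
    obtain ⟨v1, v2⟩ := v
    have hv1 : v2 = j + 1 := by simp only [Incident] at hv hv'; omega
    obtain rfl | rfl : v1 = i ∨ v1 = i + 1 := hv.1
    · subst hv1
      change K _ _ + _ = K _ _ + _
      rw [← h2] at h1
      rw [← sub_eq_zero] at h1 ⊢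
      rw [← neg_eq_zero, ← h1]; abel
    · subst hv1
      change K _ _ + _ = K _ _ + _
      rw [← sub_eq_zero] at h1 ⊢
      rw [← neg_eq_zero, ← h1]; abel
  have hG : ∀ f ∈ I ×ˢ J, ∀ f' ∈ I ×ˢ J, ∀ v, Incident v f → Incident v f' → G v f = G v f' := by
    rintro ⟨i, j⟩ ⟨hi, hj⟩ ⟨i', j'⟩ ⟨hi', hj'⟩ v hv hv'
    simp only at hi hj hi' hj'
    -- Two faces at `v` may be diagonal neighbours; the product shape of the domain guarantees that
    -- the intermediate face `(i', j)` belongs to it.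
    have hmid : Incident v (i', j) := ⟨hv'.1, hv.2⟩
    trans G v (i', j)
    · obtain rfl | rfl | rfl : i' = i ∨ i' = i + 1 ∨ i = i' + 1 := by
        simp only [Incident] at hv hv'; omega
      · rfl
      · exact hGr _ _ hi hi' hj v hv hmid
      · exact (hGr _ _ hi' hi hj v hmid hv).symm
    · obtain rfl | rfl | rfl : j' = j ∨ j' = j + 1 ∨ j = j' + 1 := by
        simp only [Incident] at hv hv'; omega
      · rfl
      · exact hGu _ _ hi' hj hj' v hmid hv'
      · exact (hGu _ _ hi' hj' hj v hv' hmid).symm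
  refine ⟨fun v => if h : ∃ f ∈ I ×ˢ J, Incident v f then G v h.choose else 0,
    fun f => K f.1 f.2, fun f hf v hv => ?_⟩
  have h : ∃ f ∈ I ×ˢ J, Incident v f := ⟨f, hf, hv⟩
  simp only [dif_pos h]
  exact hG _ h.choose_spec.1 _ hf v h.choose_spec.2 hv

/-! ### Circles in the upper half of the unit sphere -/

theorem exists_isFrame {n : LorentzSpace} (h : lorentzInner n n = -1) :
    ∃ u, IsFrame n u := by
  have hn : n 0 ^ 2 + n 1 ^ 2 - n 2 ^ 2 = -1 := by
    simp only [lorentzInner] at h; linear_combination h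
  have hpos : 0 < n 2 ^ 2 - n 0 ^ 2 := by nlinarith [sq_nonneg (n 1)]
  have hs := Real.sq_sqrt hpos.le
  have hs0 : √(n 2 ^ 2 - n 0 ^ 2) ≠ 0 := (Real.sqrt_pos.mpr hpos).ne'
  refine ⟨(√(n 2 ^ 2 - n 0 ^ 2))⁻¹ • ![n 2, 0, n 0], h, ?_, ?_⟩
  · rw [lorentzInner_smul_left, lorentzInner_smul_right]
    simp only [lorentzInner, Matrix.cons_val]
    field_simp
    linear_combination -hs
  · rw [lorentzInner_smul_right]
    simp only [lorentzInner, Matrix.cons_val]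
    ring

/-- The center of a circle in the unit sphere lies on its axis through the origin. -/
theorem SpacelikeCircle.center_eq_of_subset {C : SpacelikeCircle}
    (hC : C.points ⊆ upperUnitSphere) :
    C.center = -lorentzInner C.center C.normal • C.normal ∧
      lorentzInner C.center C.center = -1 - C.radius ^ 2 := by
  obtain ⟨u, hu⟩ := exists_isFrame (n := C.normal) C.normal_sq
  have key : ∀ v, lorentzInner v v = 1 → lorentzInner v C.normal = 0 →
      lorentzInner C.center v = 0 ∧ lorentzInner C.center C.center = -1 - C.radius ^ 2 := by
    intro v hv hn
    -- The two opposite points `C ± r v` of the circle lie on the unit sphere; the difference of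
    -- their equations gives `C · v = 0`, and the sum gives `C · C`.
    have hmem : ∀ a : ℝ, a ^ 2 = 1 → lorentzSq (C.center + (a * C.radius) • v) = -1 := by
      intro a ha
      refine (hC ⟨?_, ?_⟩).1
      · rw [add_sub_cancel_left, lorentzInner_smul_left, hn, mul_zero]
      · rw [add_sub_cancel_left, lorentzSq, lorentzInner_smul_left, lorentzInner_smul_right, hv]
        linear_combination C.radius ^ 2 * ha
    have h1 := hmem 1 (by norm_num)
    have h2 := hmem (-1) (by norm_num)
    simp only [lorentzSq, lorentzInner_add_left, lorentzInner_add_right, lorentzInner_smul_left,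
      lorentzInner_smul_right, hv, lorentzInner_comm v] at h1 h2
    have hr := C.radius_pos.ne'
    constructor
    · apply mul_left_cancel₀ hr
      linear_combination (h1 - h2) / 4
    · linear_combination (h1 + h2) / 2
  obtain ⟨h1, h2⟩ := key u hu.unit (by rw [lorentzInner_comm, hu.orthogonal])
  obtain ⟨h3, -⟩ := key (lorentzCross C.normal u) hu.inner_binormal_self
    (by rw [lorentzInner_comm, lorentzInner_cross_left_self])
  refine ⟨?_, h2⟩
  have h4 := hu.expand C.center
  rw [h1, h3] at h4
  linear_combination (norm := module) h4

/-- The data of a Koebe net at a face and an incident edge: the contact point `N`, the center `M`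
and radius `R` of the sphere and the center `C` and radius `r` of the circle. -/
structure KoebeCorner (N M C : LorentzSpace) (R r : ℝ) : Prop where
  frame : IsFrame N (R⁻¹ • (N - M))
  radius_ne : R ≠ 0
  circle_radius_pos : 0 < r
  center_sq : lorentzInner C C = -1 - r ^ 2
  inner_center : lorentzInner N C = -1 - r ^ 2
  orthogonal : lorentzInner C (R⁻¹ • (N - M)) = 0

/-- The center of `C` lies on the axis of the circle, so the sphere normal at `K` is orthogonal to
it, and then also to `K`. This makes `K` and the normal a frame. -/
theorem SpacelikeCircle.OrthogonalAt.koebeCorner {C : SpacelikeCircle} {S : OrientedSphere}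
    {K : LorentzSpace} (h : C.OrthogonalAt S K) (hC : C.points ⊆ upperUnitSphere)
    (hS : S.radius ≠ 0) : KoebeCorner K S.center C.center S.radius C.radius := by
  obtain ⟨hKC, hKS, h1, h2⟩ := h
  obtain ⟨hc, hcc⟩ := SpacelikeCircle.center_eq_of_subset hC
  have hCT : lorentzInner (S.normal K) C.center = 0 := by
    rw [hc, lorentzInner_smul_right, h1, mul_zero]
  have hKT : lorentzInner (S.normal K) K = 0 := by
    rw [lorentzInner_sub_right, hCT] at h2; linarith
  refine ⟨⟨(hC hKC).1, ?_, by rw [lorentzInner_comm]; exact hKT⟩, hS, C.radius_pos, hcc, ?_,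
    by rw [lorentzInner_comm]; exact hCT⟩
  · have hKS' : lorentzInner (K - S.center) (K - S.center) = S.radius ^ 2 := hKS
    rw [lorentzInner_smul_left, lorentzInner_smul_right, hKS']
    field_simp
  · have h3 : lorentzInner (K - C.center) C.center = 0 := by
      rw [hc, lorentzInner_smul_right, ← hc, hKC.1, mul_zero]
    rw [lorentzInner_sub_left, hcc] at h3
    linarith

/-! ### Metric relations at a corner of a Koebe net, and kites. -/

namespace KoebeCorner

variable {N N' M C : LorentzSpace} {R r : ℝ}

theorem inner_sphere (h : KoebeCorner N M C R r) : lorentzInner N M = -1 := by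
  have h1 := h.frame.orthogonal
  rw [lorentzInner_smul_right, lorentzInner_sub_right, h.frame.timelike] at h1
  have := (mul_eq_zero.mp h1).resolve_left (inv_ne_zero h.radius_ne)
  linarith

/-- The sphere intersects the unit sphere orthogonally, so `M · M` depends on `R` alone and not on
the contact point. -/
theorem sphere_sq (h : KoebeCorner N M C R r) : lorentzInner M M = R ^ 2 - 1 := by
  have h1 := h.frame.unit
  have hR := h.radius_ne
  simp only [lorentzInner_smul_right, lorentzInner_smul_left, lorentzInner_sub_right,
    lorentzInner_sub_left, h.frame.timelike, lorentzInner_comm M N, h.inner_sphere] at h1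
  field_simp at h1
  linear_combination h1

/-- The coordinate of the circle center in the direction of the binormal. -/
noncomputable def offset (N M C : LorentzSpace) (R : ℝ) : ℝ :=
  lorentzInner C (lorentzCross N (R⁻¹ • (N - M)))

theorem binormal_eq (N M : LorentzSpace) (R : ℝ) :
    lorentzCross N (R⁻¹ • (N - M)) = -R⁻¹ • lorentzCross N M := by
  rw [lorentzCross_smul_right, lorentzCross_sub_right, lorentzCross_self]; module

theorem center_eq (h : KoebeCorner N M C R r) :
    C = (1 + r ^ 2) • N + offset N M C R • lorentzCross N (R⁻¹ • (N - M)) := by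
  have h1 := h.frame.expand C
  rw [h.orthogonal, lorentzInner_comm C N, h.inner_center] at h1
  rw [offset]
  linear_combination (norm := module) h1

theorem offset_sq (h : KoebeCorner N M C R r) : offset N M C R ^ 2 = r ^ 2 * (1 + r ^ 2) := by
  have h1 := congrArg (lorentzInner C) h.center_eq
  rw [lorentzInner_add_right, lorentzInner_smul_right, lorentzInner_smul_right, h.center_sq,
    lorentzInner_comm C N, h.inner_center, ← offset] at h1
  linear_combination -h1

theorem offset_ne_zero (h : KoebeCorner N M C R r) : offset N M C R ≠ 0 := by
  intro h0
  have h1 := h.offset_sq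
  rw [h0] at h1
  have := h.circle_radius_pos
  have : 0 < r ^ 2 * (1 + r ^ 2) := by positivity
  linarith

theorem radii_pos (h : KoebeCorner N M C R r) : 0 < r ^ 2 + R ^ 2 := by
  have := h.circle_radius_pos
  positivity

/-- The two contact points on the common sphere and circle, the sphere center and the circle center
form a kite. -/
def IsKite (N N' M C : LorentzSpace) (R r : ℝ) : Prop :=
  (r ^ 2 + R ^ 2) • (N + N') = (2 : ℝ) • (r ^ 2 • M + R ^ 2 • C)

theorem IsKite.eq_sub (hk : IsKite N N' M C R r) (h : KoebeCorner N M C R r) :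
    N' = (2 * r ^ 2 / (r ^ 2 + R ^ 2)) • M + (2 * R ^ 2 / (r ^ 2 + R ^ 2)) • C - N := by
  have hp := h.radii_pos.ne'
  have h1 : N + N' = (r ^ 2 + R ^ 2)⁻¹ • (2 : ℝ) • (r ^ 2 • M + R ^ 2 • C) := by
    rw [← hk, smul_smul, inv_mul_cancel₀ hp, one_smul]
  rw [eq_sub_iff_add_eq', h1]
  match_scalars <;> field_simp

/-- The triple product of `N`, `M`, `C` changes sign when `N` is replaced by `N'`, because `N + N'`
lies in the span of `M` and `C`. -/
theorem IsKite.offset_eq (hk : IsKite N N' M C R r) (h : KoebeCorner N M C R r) :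
    offset N' M C R = -offset N M C R := by
  have e : ∀ a b : ℝ, lorentzInner C (lorentzCross (a • M + b • C - N) M) =
      -lorentzInner C (lorentzCross N M) := by
    intro a b
    simp [lorentzInner, lorentzCross]; ring
  rw [offset, offset, binormal_eq, binormal_eq, lorentzInner_smul_right, lorentzInner_smul_right,
    hk.eq_sub h, e]
  ring

/-- The vector from the contact point to the sphere center in the associated dual net. -/
noncomputable def sphereEdge (N M : LorentzSpace) (R s φ : ℝ) : LorentzSpace :=
  (s / R ^ 2) • (Real.cos φ • (M - N) + Real.sin φ • lorentzCross N M)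

/-- The vector from the contact point to the center of the black sphere in the associated
congruence. -/
noncomputable def circleEdge (N M C : LorentzSpace) (R r s σ φ : ℝ) : LorentzSpace :=
  (s / r ^ 2) • (Real.cos φ • (C - N) + Real.sin φ • lorentzCross N C) +
    (σ * s / offset N M C R) • C

/-- The cosine terms cancel by the kite relation. The sine terms on each side reduce to the same
multiple of `M × C`. In the extra `C`-term, sign and offset both change between the faces, so it
contributes equally at both and drops out. -/
theorem IsKite.closed (hk : IsKite N N' M C R r) (h : KoebeCorner N M C R r) (s σ φ : ℝ) :
    sphereEdge N M R s φ - sphereEdge N' M R (-s) φ =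
      circleEdge N M C R r (-s) σ φ - circleEdge N' M C R r s σ φ := by
  have hp := h.radii_pos.ne'
  have hr := h.circle_radius_pos.ne'
  have hR := h.radius_ne
  have h0 := h.offset_ne_zero
  have hN := hk.eq_sub h
  have e1 : ∀ a b : ℝ, lorentzCross (a • M + b • C - N) M =
      -b • lorentzCross M C - lorentzCross N M := by
    intro a b
    ext i; fin_cases i <;> simp [lorentzCross] <;> ring
  have e2 : ∀ a b : ℝ, lorentzCross (a • M + b • C - N) C =
      a • lorentzCross M C - lorentzCross N C := by
    intro a b
    ext i; fin_cases i <;> simp [lorentzCross] <;> ring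
  rw [sphereEdge, sphereEdge, circleEdge, circleEdge, hk.offset_eq h, hN, e1, e2]
  match_scalars <;> field_simp <;> ring

theorem sphereEdge_eq (h : KoebeCorner N M C R r) (s φ : ℝ) :
    sphereEdge N M R s φ = -(s * R⁻¹) • lorentzRotation φ N (R⁻¹ • (N - M)) := by
  have hR := h.radius_ne
  rw [h.frame.rotation_tangent, binormal_eq, sphereEdge]
  match_scalars <;> field_simp

theorem circleEdge_eq (h : KoebeCorner N M C R r) (s σ φ : ℝ) :
    circleEdge N M C R r s σ φ =
      (s * Real.cos φ + σ * s * (1 + r ^ 2) / offset N M C R) • N -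
      (s / r ^ 2 * offset N M C R * Real.sin φ) • R⁻¹ • (N - M) +
      (s / r ^ 2 * offset N M C R * Real.cos φ + σ * s) • lorentzCross N (R⁻¹ • (N - M)) := by
  have hr := h.circle_radius_pos.ne'
  have h0 := h.offset_ne_zero
  have hC := h.center_eq
  have hNC : lorentzCross N C = -offset N M C R • R⁻¹ • (N - M) := by
    rw [hC, lorentzCross_add_right, lorentzCross_smul_right, lorentzCross_smul_right,
      lorentzCross_self, h.frame.cross_binormal, ← hC]
    module
  rw [circleEdge, hNC]
  -- `C` also occurs inside `offset`, so the expansion is substituted only in the explicit slots.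
  have hC' : ∀ a b : ℝ, a • (Real.cos φ • (C - N) + b • R⁻¹ • (N - M)) +
      (σ * s / offset N M C R) • C = a • (Real.cos φ • ((1 + r ^ 2) • N +
        offset N M C R • lorentzCross N (R⁻¹ • (N - M)) - N) + b • R⁻¹ • (N - M)) +
      (σ * s / offset N M C R) • ((1 + r ^ 2) • N +
        offset N M C R • lorentzCross N (R⁻¹ • (N - M))) := by
    intro a b; rw [← hC]
  rw [smul_smul (Real.sin φ), hC']
  generalize lorentzCross N (R⁻¹ • (N - M)) = B
  generalize R⁻¹ • (N - M) = T
  match_scalars <;> field_simp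
  ring

/-- Both directions are combinations of `n`, `M`, `n × M` with the same coefficients for `n = N` and
`n = N'`. Since `n · M = -1` for both, only `N · N'` remains. The angle survives only in a factor
shared by all contact points of the sphere, which is why the X-variable cannot see it. -/
theorem inner_isotropic_isotropic {N' C' : LorentzSpace} {r' : ℝ} (h : KoebeCorner N M C R r)
    (h' : KoebeCorner N' M C' R r') {σ φ : ℝ} (hσ : σ ^ 2 = 1) :
    lorentzInner (N + σ • lorentzRotation φ N (lorentzCross N (R⁻¹ • (N - M))))
        (N' + σ • lorentzRotation φ N' (lorentzCross N' (R⁻¹ • (N' - M)))) =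
      -(R⁻¹ - σ * Real.sin φ) ^ 2 / 2 * lorentzInner (N - N') (N - N') := by
  have hR := h.radius_ne
  have hE : ∀ n : LorentzSpace, n + σ • (Real.cos φ • (-R⁻¹ • lorentzCross n M) -
      Real.sin φ • R⁻¹ • (n - M)) = (1 - σ * R⁻¹ * Real.sin φ) • n +
        (σ * R⁻¹ * Real.sin φ) • M - (σ * R⁻¹ * Real.cos φ) • lorentzCross n M := by
    intro n; module
  have h1 : lorentzInner N (lorentzCross N' M) + lorentzInner (lorentzCross N M) N' = 0 := by
    simp [lorentzInner, lorentzCross]; ring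
  have h2 : lorentzInner (lorentzCross N M) (lorentzCross N' M) =
      1 - lorentzInner N N' * (R ^ 2 - 1) := by
    rw [lorentzInner_cross_cross, h.inner_sphere, lorentzInner_comm M N', h'.inner_sphere,
      h.sphere_sq]
    ring
  rw [h.frame.rotation_binormal, h'.frame.rotation_binormal, binormal_eq, binormal_eq, hE, hE]
  simp only [lorentzInner_add_left, lorentzInner_add_right, lorentzInner_sub_left,
    lorentzInner_sub_right, lorentzInner_smul_left, lorentzInner_smul_right, h2,
    lorentzInner_cross_right_self, lorentzInner_comm (lorentzCross N M) M, h.inner_sphere,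
    lorentzInner_comm M N', h'.inner_sphere, h.sphere_sq, h.frame.timelike, h'.frame.timelike,
    lorentzInner_comm N' N]
  have hs := Real.sin_sq_add_cos_sq φ
  have hi : R⁻¹ * R = 1 := inv_mul_cancel₀ hR
  generalize R⁻¹ = ρ at *
  generalize lorentzInner N N' = x at *
  generalize Real.sin φ = S at *
  generalize Real.cos φ = c at *
  linear_combination (-(1 - σ * ρ * S) * (σ * ρ * c)) * h1 +
    ((S ^ 2 - x * c ^ 2) * ρ ^ 2 * R ^ 2 + (1 + x) * (ρ ^ 2 - S ^ 2)) * hσ +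
    (S ^ 2 - x * c ^ 2) * (ρ * R + 1) * hi + ((1 + x) * σ ^ 2 * ρ ^ 2 - x) * hs

/-- A line through the contact point with the direction of the associated family is in oriented
contact with the white sphere. -/
theorem contactLine_sphere (h : KoebeCorner N M C R r) {σ t s φ : ℝ} (hσ : σ ^ 2 = 1)
    (hs : s ^ 2 = 1) (ht : t ≠ 0) {L : OrientedIsotropicLine}
    (hD : L.dir = t • (N + σ • lorentzRotation φ N (lorentzCross N (R⁻¹ • (N - M)))))
    (hD2 : L.dir 2 = σ * s) {K : LorentzSpace} (hK : K ∈ L.points) :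
    (OrientedSphere.mk (K + sphereEdge N M R s φ) R⁻¹).ContactLine L := by
  have hF := h.frame.rotation φ
  rw [← h.frame.cross_rotation_tangent] at hD
  have h1 : lorentzInner (sphereEdge N M R s φ) L.dir = 0 := by
    rw [h.sphereEdge_eq, hD, lorentzInner_smul_left, lorentzInner_smul_right,
      lorentzInner_add_right, lorentzInner_smul_right, lorentzInner_cross_right_self,
      lorentzInner_comm _ N, hF.orthogonal]
    ring
  rw [OrientedSphere.contactLine_iff hK]
  refine ⟨by rwa [add_sub_cancel_left], ?_⟩
  rw [add_sub_cancel_left, hF.planarDet_eq hσ ht hD h1, h.sphereEdge_eq, lorentzInner_smul_left,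
    hF.unit, hD2]
  linear_combination R⁻¹ * s ^ 2 * hσ + R⁻¹ * hs

/-- A line through the contact point with the direction of the associated family is in oriented
contact with the black sphere. -/
theorem contactLine_circle (h : KoebeCorner N M C R r) {σ t s φ : ℝ} (hσ : σ ^ 2 = 1)
    (hs : s ^ 2 = 1) (ht : t ≠ 0) {L : OrientedIsotropicLine}
    (hD : L.dir = t • (N + σ • lorentzRotation φ N (lorentzCross N (R⁻¹ • (N - M)))))
    (hD2 : L.dir 2 = σ * s) {K : LorentzSpace} (hK : K ∈ L.points) :
    (OrientedSphere.mk (K + circleEdge N M C R r (-s) σ φ) (σ * Real.sin φ)).ContactLine L := by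
  have hF := h.frame.rotation φ
  have hr := h.circle_radius_pos.ne'
  have h0 := h.offset_ne_zero
  have hsq := h.offset_sq
  have hcs := Real.sin_sq_add_cos_sq φ
  have h1 : lorentzInner (circleEdge N M C R r (-s) σ φ) L.dir = 0 := by
    have hf := h.frame
    rw [h.circleEdge_eq, hD, h.frame.rotation_binormal]
    generalize offset N M C R = δ at *
    clear hD hF h
    generalize R⁻¹ • (N - M) = T at *
    simp only [lorentzInner_add_left, lorentzInner_add_right, lorentzInner_sub_left,
      lorentzInner_sub_right, lorentzInner_smul_left, lorentzInner_smul_right,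
      hf.timelike, hf.inner_binormal_self, lorentzInner_cross_left_self, hf.orthogonal,
      lorentzInner_cross_right_self, lorentzInner_comm T N,
      lorentzInner_comm (lorentzCross N _) N, hf.unit, lorentzInner_comm (lorentzCross N _) T]
    field_simp
    linear_combination (t * s) * (-(r ^ 2 * Real.cos φ * δ) * hσ - σ * δ ^ 2 * hcs - σ * hsq)
  rw [OrientedSphere.contactLine_iff hK]
  rw [← h.frame.cross_rotation_tangent] at hD
  refine ⟨by rwa [add_sub_cancel_left], ?_⟩
  rw [add_sub_cancel_left, hF.planarDet_eq hσ ht hD h1, h.circleEdge_eq, hD2,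
    h.frame.rotation_tangent]
  have hf := h.frame
  generalize offset N M C R = δ at *
  clear hD hF h h1
  generalize R⁻¹ • (N - M) = T at *
  simp only [lorentzInner_add_left, lorentzInner_add_right, lorentzInner_sub_left,
    lorentzInner_smul_left, lorentzInner_smul_right,
    hf.inner_binormal_self, lorentzInner_cross_left_self, hf.orthogonal,
    lorentzInner_cross_right_self, hf.unit, lorentzInner_comm (lorentzCross N _) T]
  linear_combination (σ * s ^ 2 * Real.sin φ) * hσ + (σ * Real.sin φ) * hs

/-- The apex of a null-sphere in oriented contact with the lines at two adjacent faces lies on the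
axis of the circle. -/
theorem IsKite.exists_smul_center (hk : IsKite N N' M C R r) (h : KoebeCorner N M C R r)
    {y : LorentzSpace} (hy : lorentzInner y (R⁻¹ • (N - M)) = 0)
    (hy' : lorentzInner y (R⁻¹ • (N' - M)) = 0) : ∃ l : ℝ, y = l • C := by
  have hR := h.radius_ne
  have hp := h.radii_pos.ne'
  have hCC : lorentzInner C C ≠ 0 := by
    rw [h.center_sq]; nlinarith [sq_nonneg r]
  have h0 := h.offset_ne_zero
  have hN := hk.eq_sub h
  refine ⟨lorentzInner y C / lorentzInner C C, ?_⟩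
  rw [← sub_eq_zero]
  -- The component `z` of `y` orthogonal to `C` is shown to be orthogonal to the whole frame.
  set z := y - (lorentzInner y C / lorentzInner C C) • C with hz
  have hzC : lorentzInner z C = 0 := by
    rw [hz, lorentzInner_sub_left, lorentzInner_smul_left]
    field_simp
    ring
  have hzT : lorentzInner z (R⁻¹ • (N - M)) = 0 := by
    rw [hz, lorentzInner_sub_left, lorentzInner_smul_left, hy, h.orthogonal]
    ring
  have hyN : lorentzInner y N = lorentzInner y M := by
    rw [lorentzInner_smul_right, lorentzInner_sub_right] at hy
    linarith [(mul_eq_zero.mp hy).resolve_left (inv_ne_zero hR)]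
  have hyN' : lorentzInner y N' = lorentzInner y M := by
    rw [lorentzInner_smul_right, lorentzInner_sub_right] at hy'
    linarith [(mul_eq_zero.mp hy').resolve_left (inv_ne_zero hR)]
  -- `N'` is an affine combination of `M`, `C`, `N` with a non-zero coefficient at `C`, and `y` has
  -- equal products with `N`, `N'` and `M`.
  have hyC : lorentzInner y C = lorentzInner y M := by
    rw [hN, lorentzInner_sub_right, lorentzInner_add_right, lorentzInner_smul_right,
      lorentzInner_smul_right, hyN] at hyN'
    field_simp at hyN'
    have : R ^ 2 * (lorentzInner y C - lorentzInner y M) = 0 := by linear_combination hyN' / 2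
    linarith [(mul_eq_zero.mp this).resolve_left (pow_ne_zero 2 hR)]
  have hzN : lorentzInner z N = 0 := by
    rw [hz, lorentzInner_sub_left, lorentzInner_smul_left, hyN, hyC, lorentzInner_comm C N,
      h.inner_center, ← h.center_sq]
    field_simp
    ring
  have hzB : lorentzInner z (lorentzCross N (R⁻¹ • (N - M))) = 0 := by
    rw [h.center_eq, lorentzInner_add_right, lorentzInner_smul_right, hzN,
      lorentzInner_smul_right] at hzC
    simpa [h0] using hzC
  rw [h.frame.expand z, hzN, hzT, hzB]
  module

/-- The relation between the sign of the isotropic direction and the position of the apex of a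
null-sphere on the axis of the circle. -/
theorem sign_eq (h : KoebeCorner N M C R r) {s l a σ : ℝ} (hσ : σ ^ 2 = 1)
    (ha : a • (N + σ • lorentzCross N (R⁻¹ • (N - M))) = (s / r ^ 2) • (C - N) + l • C) :
    s = l * offset N M C R * σ := by
  have hr := h.circle_radius_pos
  have h0 := h.offset_ne_zero
  have hsq := h.offset_sq
  have h1 := congrArg (lorentzInner N) ha
  have h2 := congrArg (lorentzInner (lorentzCross N (R⁻¹ • (N - M)))) ha
  have hf := h.frame
  have hNC := h.inner_center
  have hoff : lorentzInner C (lorentzCross N (R⁻¹ • (N - M))) = offset N M C R := rfl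
  generalize offset N M C R = δ at *
  clear ha h
  generalize R⁻¹ • (N - M) = T at *
  simp only [lorentzInner_add_right, lorentzInner_smul_right, lorentzInner_sub_right,
    hf.timelike, lorentzInner_cross_left_self, hNC,
    lorentzInner_comm (lorentzCross N _) N, lorentzInner_comm (lorentzCross N _) C, hoff,
    hf.inner_binormal_self] at h1 h2
  have hr0 := hr.ne'
  field_simp at h1 h2
  -- Equality would give `r⁴ = r² (1 + r²)`.
  have hne : σ * δ - r ^ 2 ≠ 0 := by
    intro h3
    have h4 : σ * δ = r ^ 2 := by linarith
    have h5 : (σ * δ) ^ 2 = r ^ 2 * (1 + r ^ 2) := by rw [mul_pow, hσ, hsq, one_mul]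
    rw [h4] at h5
    nlinarith [pow_pos hr 2]
  have key : (σ * δ - r ^ 2) * (s - l * δ * σ) = 0 := by
    linear_combination (-σ) * h2 + (a * r ^ 2 - l * δ ^ 2) * hσ - h1 - l * hsq
  linarith [(mul_eq_zero.mp key).resolve_left hne]

end KoebeCorner

/-! ### Koebe nets and their Christoffel duals -/

theorem units_sq_real (σ : ℤˣ) : ((σ : ℤ) : ℝ) ^ 2 = 1 := by
  rcases Int.units_eq_one_or σ with rfl | rfl <;> norm_num

theorem exists_white (f : ℤ × ℤ) : ∃ w, IsWhite w ∧ Incident w f :=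
  let ⟨w, _, hw, _, hwf, _⟩ := exists_two_white f
  ⟨w, hw, hwf⟩

theorem exists_black (f : ℤ × ℤ) : ∃ b, IsBlack b ∧ Incident b f := by
  obtain ⟨w, b, h, -⟩ := exists_sharedEdge_right f.1 f.2
  exact ⟨b, h.black, h.black_left⟩

theorem lorentzSq_sub_comm (x y : LorentzSpace) : lorentzSq (x - y) = lorentzSq (y - x) := by
  simp only [lorentzSq, lorentzInner, Pi.sub_apply]; ring

theorem lorentzRotation_zero (N v : LorentzSpace) : lorentzRotation 0 N v = v := by
  simp [lorentzRotation]

namespace SIsothermicNet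

variable {D : Set (ℤ × ℤ)} {h k : SIsothermicNet D}

theorem normal_eq (k : SIsothermicNet D) {f w w' : ℤ × ℤ} (hf : f ∈ D) (hw : IsWhite w)
    (hw' : IsWhite w') (hwf : Incident w f) (hwf' : Incident w' f) :
    (k.sphere w).normal (k.pt f) = (k.sphere w').normal (k.pt f) :=
  (k.touch f hf w w' hw hw' hwf hwf').2.2

theorem IsKoebe.koebeCorner (hk : k.IsKoebe) {f w b : ℤ × ℤ} (hf : f ∈ D) (hw : IsWhite w)
    (hb : IsBlack b) (hwf : Incident w f) (hbf : Incident b f) :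
    KoebeCorner (k.pt f) (k.sphere w).center (k.circle b).center (k.sphere w).radius
      (k.circle b).radius :=
  (k.orthogonal f hf w b hw hb hwf hbf).koebeCorner (hk b ⟨f, hf, hbf⟩ hb)
    (k.timelike w ⟨f, hf, hwf⟩ hw)

theorem IsKoebe.isFrame (hk : k.IsKoebe) {f w : ℤ × ℤ} (hf : f ∈ D) (hw : IsWhite w)
    (hwf : Incident w f) : IsFrame (k.pt f) ((k.sphere w).normal (k.pt f)) :=
  let ⟨_, hb, hbf⟩ := exists_black f
  (hk.koebeCorner hf hw hb hwf hbf).frame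

/-- Dualisation is an involution: the edges of `h` are recovered from those of `k` by the same
formula. -/
theorem IsChristoffelDual.sphere_center (hd : h.IsChristoffelDual k) {f w : ℤ × ℤ} (hf : f ∈ D)
    (hw : IsWhite w) (hwf : Incident w f) :
    (h.sphere w).center - h.pt f =
      (edgeSign w f / (k.sphere w).radius ^ 2) • ((k.sphere w).center - k.pt f) := by
  have hv : IsVertex D w := ⟨f, hf, hwf⟩
  have h1 : lorentzSq ((h.sphere w).center - h.pt f) = (h.sphere w).radius ^ 2 := by
    rw [lorentzSq_sub_comm]
    exact (h.touch f hf w w hw hw hwf hwf).1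
  have h0 := h.timelike w hv hw
  rw [hd.1 f hf w hw hwf, h1, hd.2.2 w hv hw, smul_smul]
  have h2 : edgeSign w f / (h.sphere w).radius⁻¹ ^ 2 *
      (edgeSign w f / (h.sphere w).radius ^ 2) = 1 := by
    field_simp
    exact edgeSign_sq w f
  rw [h2, one_smul]

theorem IsChristoffelDual.circle_center (hd : h.IsChristoffelDual k) {f b : ℤ × ℤ} (hf : f ∈ D)
    (hb : IsBlack b) (hbf : Incident b f) :
    (h.circle b).center - h.pt f =
      (edgeSign b f / (k.circle b).radius ^ 2) • ((k.circle b).center - k.pt f) := by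
  obtain ⟨w, hw, hwf⟩ := exists_white f
  have h1 : lorentzSq ((h.circle b).center - h.pt f) = (h.circle b).radius ^ 2 := by
    rw [lorentzSq_sub_comm]
    exact (h.orthogonal f hf w b hw hb hwf hbf).1.2
  -- No relation between the circle radii is assumed; the radius in `k` is read off from the length
  -- of its edge.
  have h2 : lorentzSq ((k.circle b).center - k.pt f) = (k.circle b).radius ^ 2 := by
    rw [lorentzSq_sub_comm]
    exact (k.orthogonal f hf w b hw hb hwf hbf).1.2
  have h0 := (h.circle b).radius_pos.ne'
  have hs := edgeSign_sq b f
  rw [← h2, hd.2.1 f hf b hb hbf, lorentzSq, lorentzInner_smul_left, lorentzInner_smul_right,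
    ← lorentzSq, h1, smul_smul]
  have h3 : edgeSign b f / (edgeSign b f / (h.circle b).radius ^ 2 *
      (edgeSign b f / (h.circle b).radius ^ 2 * (h.circle b).radius ^ 2)) *
      (edgeSign b f / (h.circle b).radius ^ 2) = 1 := by
    have := edgeSign_ne_zero b f
    field_simp
  rw [h3, one_smul]

/-- The quad `f, w, f', b` closes up in `h`; written through the edges of `k`, this closing
condition is the kite relation. -/
theorem IsChristoffelDual.isKite (hd : h.IsChristoffelDual k) {f f' w b : ℤ × ℤ} (hf : f ∈ D)
    (hf' : f' ∈ D) (e : SharedEdge f f' w b) :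
    KoebeCorner.IsKite (k.pt f) (k.pt f') (k.sphere w).center (k.circle b).center
      (k.sphere w).radius (k.circle b).radius := by
  have h1 := hd.sphere_center hf e.white e.white_left
  have h2 := hd.sphere_center hf' e.white e.white_right
  have h3 := hd.circle_center hf e.black e.black_left
  have h4 := hd.circle_center hf' e.black e.black_right
  rw [edgeSign_black e.white e.black e.white_left e.black_left] at h3
  rw [edgeSign_black e.white e.black e.white_right e.black_right, e.edgeSign_right] at h4
  rw [e.edgeSign_right] at h2
  have hR := k.timelike w ⟨f, hf, e.white_left⟩ e.white
  have hr := (k.circle b).radius_pos.ne'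
  have hs := edgeSign_sq w f
  generalize edgeSign w f = s at *
  generalize (k.sphere w).radius = R at *
  generalize (k.circle b).radius = r at *
  have h5 : (s / R ^ 2) • ((k.sphere w).center - k.pt f) -
      (-s / r ^ 2) • ((k.circle b).center - k.pt f) =
      (-s / R ^ 2) • ((k.sphere w).center - k.pt f') -
      (- -s / r ^ 2) • ((k.circle b).center - k.pt f') := by
    rw [← h1, ← h2, ← h3, ← h4]; abel
  have h6 := congrArg (fun x => (s * R ^ 2 * r ^ 2) • x) h5
  simp only [smul_sub, smul_smul] at h6
  have e1 : s * R ^ 2 * r ^ 2 * (s / R ^ 2) = r ^ 2 := by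
    field_simp; linear_combination hs
  have e2 : s * R ^ 2 * r ^ 2 * (-s / r ^ 2) = -R ^ 2 := by
    field_simp; linear_combination -hs
  have e3 : s * R ^ 2 * r ^ 2 * (-s / R ^ 2) = -r ^ 2 := by
    field_simp; linear_combination -hs
  have e4 : s * R ^ 2 * r ^ 2 * (- -s / r ^ 2) = R ^ 2 := by
    field_simp; linear_combination hs
  rw [e1, e2, e3, e4] at h6
  rw [KoebeCorner.IsKite]
  linear_combination (norm := module) -h6

end SIsothermicNet

/-! ### A maximal congruence belongs to its associated family -/

namespace NullCongruence

variable {D : Set (ℤ × ℤ)} {c : NullCongruence D} {h k : SIsothermicNet D}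

/-- The line of `c` at the face `f` has the direction of the congruence number `σ`. -/
def HasSign (c : NullCongruence D) (k : SIsothermicNet D) (f : ℤ × ℤ) (σ : ℤˣ) : Prop :=
  ∃ t : ℝ, ∀ w, IsWhite w → Incident w f → (c.line f).dir =
    t • (k.pt f + ((σ : ℤ) : ℝ) • lorentzCross (k.pt f) ((k.sphere w).normal (k.pt f)))

/-- Both white centers lie on the line through `h.pt f` in direction `T`. Subtracting their contact
conditions makes `T` orthogonal to the isotropic direction and fixes its planar determinant. This
puts `h.pt f` on the line and leaves two possible directions. -/
theorem line_of_isIsothermic (hc : c.IsIsothermic) (hk : k.IsKoebe) (hh : h.CorrespondsTo c)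
    (hd : h.IsChristoffelDual k) {f : ℤ × ℤ} (hf : f ∈ D) :
    h.pt f ∈ (c.line f).points ∧ ∃ σ, c.HasSign k f σ := by
  obtain ⟨w, w', hw, hw', hwf, hwf', hne⟩ := exists_two_white f
  have hv : IsVertex D w := ⟨f, hf, hwf⟩
  have hv' : IsVertex D w' := ⟨f, hf, hwf'⟩
  have hF := hk.isFrame hf hw hwf
  obtain ⟨p, hp⟩ := (c.line f).exists_mem
  obtain ⟨h1, h2⟩ := (OrientedSphere.contactLine_iff hp).mp (c.contact f hf w hwf)
  obtain ⟨h3, h4⟩ := (OrientedSphere.contactLine_iff hp).mp (c.contact f hf w' hwf')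
  have hmm := hc.2 f hf w w' hw hw' hwf hwf' hne
  have hr := hd.2.2 w hv hw
  have hr' := hd.2.2 w' hv' hw'
  have hR := k.timelike w hv hw
  have hR' := k.timelike w' hv' hw'
  have hT := k.normal_eq hf hw hw' hwf hwf'
  have hm := hd.sphere_center hf hw hwf
  have hm' := hd.sphere_center hf hw' hwf'
  rw [edgeSign_eq_of_white hw hw' hwf hwf'] at hm'
  have hs := edgeSign_sq w f
  have hN : (k.sphere w).center - k.pt f =
      -((k.sphere w).radius • (k.sphere w).normal (k.pt f)) := by
    rw [OrientedSphere.normal, smul_inv_smul₀ hR, neg_sub]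
  have hN' : (k.sphere w').center - k.pt f =
      -((k.sphere w').radius • (k.sphere w).normal (k.pt f)) := by
    rw [hT, OrientedSphere.normal, smul_inv_smul₀ hR', neg_sub]
  rw [hh w hv hw] at hr hm
  rw [hh w' hv' hw'] at hr' hm'
  rw [hN, hr] at hm
  rw [hN', hr'] at hm'
  have hr0 := c.white_timelike w hv hw
  have hr0' := c.white_timelike w' hv' hw'
  have hwall : ∀ w₁, IsWhite w₁ → Incident w₁ f →
      (k.sphere w₁).normal (k.pt f) = (k.sphere w).normal (k.pt f) :=
    fun w₁ hw₁ hwf₁ => k.normal_eq hf hw₁ hw hwf₁ hwf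
  generalize edgeSign w f = s at *
  generalize (k.sphere w).normal (k.pt f) = T at *
  generalize (c.sphere w).radius = ρ at *
  generalize (c.sphere w').radius = ρ' at *
  have hm1 : (c.sphere w).center = h.pt f - (s * ρ) • T := by
    rw [sub_eq_iff_eq_add.mp hm]
    match_scalars <;> field_simp
  have hm1' : (c.sphere w').center = h.pt f - (s * ρ') • T := by
    rw [sub_eq_iff_eq_add.mp hm']
    match_scalars <;> field_simp
  -- Here the distinctness of neighbouring centers is needed: the edge between them is a non-zero
  -- multiple of `T`.
  have hρ : s * (ρ' - ρ) ≠ 0 := by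
    intro h0
    apply hmm
    have : s * ρ' = s * ρ := by linarith
    rw [hm1, hm1', this]
  have hsub : (c.sphere w).center - p - ((c.sphere w').center - p) = (s * (ρ' - ρ)) • T := by
    rw [hm1, hm1']; module
  have hTD : lorentzInner T (c.line f).dir = 0 := by
    have := congrArg (fun x => lorentzInner x (c.line f).dir) hsub
    rw [lorentzInner_sub_left, h1, h3, lorentzInner_smul_left] at this
    exact (mul_eq_zero.mp (by linarith)).resolve_left hρ
  have hTdet : planarDet (c.line f).dir T = -s := by
    have := congrArg (planarDet (c.line f).dir) hsub
    rw [planarDet_sub, h2, h4, planarDet_smul] at this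
    apply mul_left_cancel₀ hρ
    linear_combination -this + (ρ' - ρ) * hs
  have hx : h.pt f - p = ((c.sphere w).center - p) + (s * ρ) • T := by rw [hm1]; abel
  refine ⟨?_, ?_⟩
  · obtain ⟨t, ht⟩ := OrientedIsotropicLine.eq_smul_of_orthogonal (L := c.line f)
      (x := h.pt f - p)
      (by rw [hx, lorentzInner_add_left, h1, lorentzInner_smul_left, hTD]; ring)
      (by rw [hx, planarDet_add, h2, planarDet_smul, hTdet]; linear_combination -ρ * hs)
    rw [OrientedIsotropicLine.mem_points_iff hp]
    exact ⟨t, by rw [← ht]; abel⟩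
  · obtain ⟨σ, t, hσ⟩ := hF.exists_isotropic (c.line f).inner_dir
      (by rw [lorentzInner_comm]; exact hTD)
    exact ⟨σ, t, fun w₁ hw₁ hwf₁ => by rw [hwall w₁ hw₁ hwf₁]; exact hσ⟩

/-- The vector from the circle center of `h` to the apex of the null-sphere is orthogonal to `T` at
both faces, hence a multiple `l` of `C`. By `sign_eq`, `σ` is fixed by the edge sign, `l` and the
offset. Edge sign and offset both flip between the faces, so `σ` does not. -/
theorem HasSign.eq_of_sharedEdge (hk : k.IsKoebe) (hd : h.IsChristoffelDual k)
    {f f' w b : ℤ × ℤ} (hf : f ∈ D) (hf' : f' ∈ D) (e : SharedEdge f f' w b)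
    (hp : h.pt f ∈ (c.line f).points) (hp' : h.pt f' ∈ (c.line f').points) {σ σ' : ℤˣ}
    (hσ : c.HasSign k f σ) (hσ' : c.HasSign k f' σ') : σ = σ' := by
  have hcor := hk.koebeCorner hf e.white e.black e.white_left e.black_left
  have hcor' := hk.koebeCorner hf' e.white e.black e.white_right e.black_right
  have hkite := hd.isKite hf hf' e
  -- Apex and contact point both lie on the line at `g`. Their difference is split at the circle
  -- center of `h`, so that the last summand does not depend on the face.
  have key : ∀ g, g ∈ D → Incident w g → Incident b g → h.pt g ∈ (c.line g).points →
      ∀ τ : ℤˣ, c.HasSign k g τ → ∃ a : ℝ,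
        a • (k.pt g + ((τ : ℤ) : ℝ) • lorentzCross (k.pt g) ((k.sphere w).normal (k.pt g))) =
          (edgeSign b g / (k.circle b).radius ^ 2) • ((k.circle b).center - k.pt g) +
            ((c.sphere b).center - (h.circle b).center) := by
    intro g hg hwg hbg hpg τ ⟨t, ht⟩
    obtain ⟨h1, h2⟩ := (OrientedSphere.contactLine_iff hpg).mp (c.contact g hg b hbg)
    rw [c.black_null b ⟨g, hg, hbg⟩ e.black] at h2
    obtain ⟨a, ha⟩ := OrientedIsotropicLine.eq_smul_of_orthogonal h1 h2
    refine ⟨a * t, ?_⟩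
    rw [← hd.circle_center hg e.black hbg, mul_smul, ← ht w e.white hwg, ← ha]
    abel
  obtain ⟨a, ha⟩ := key f hf e.white_left e.black_left hp σ hσ
  obtain ⟨a', ha'⟩ := key f' hf' e.white_right e.black_right hp' σ' hσ'
  have orth : ∀ {N C M : LorentzSpace} {R r : ℝ}, KoebeCorner N M C R r → ∀ {a s τ : ℝ}
      {y : LorentzSpace}, a • (N + τ • lorentzCross N (R⁻¹ • (N - M))) = s • (C - N) + y →
      lorentzInner y (R⁻¹ • (N - M)) = 0 := by
    intro N C M R r hc a s τ y hy
    rw [← sub_eq_iff_eq_add'.mpr hy, lorentzInner_sub_left, lorentzInner_smul_left,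
      lorentzInner_add_left, lorentzInner_smul_left, lorentzInner_smul_left,
      lorentzInner_sub_left, hc.frame.orthogonal, hc.orthogonal,
      lorentzInner_comm, lorentzInner_cross_right_self]
    ring
  obtain ⟨l, hl⟩ := hkite.exists_smul_center hcor (orth hcor ha) (orth hcor' ha')
  rw [hl] at ha ha'
  have h1 := hcor.sign_eq (units_sq_real σ) ha
  have h2 := hcor'.sign_eq (units_sq_real σ') ha'
  rw [hkite.offset_eq hcor, edgeSign_black e.white e.black e.white_right e.black_right,
    e.edgeSign_right] at h2
  rw [edgeSign_black e.white e.black e.white_left e.black_left] at h1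
  have hne : l * KoebeCorner.offset (k.pt f) (k.sphere w).center (k.circle b).center
      (k.sphere w).radius ≠ 0 := by
    intro h0
    rw [h0, zero_mul, neg_eq_zero] at h1
    exact edgeSign_ne_zero _ _ h1
  have h3 : ((σ : ℤ) : ℝ) = ((σ' : ℤ) : ℝ) := by
    apply mul_left_cancel₀ hne
    linear_combination -h1 - h2
  exact Units.ext (by exact_mod_cast h3)

theorem exists_isAssocNullCongruence_zero {I J : Set ℤ} (hI : I.OrdConnected)
    (hJ : J.OrdConnected) {c : NullCongruence (I ×ˢ J)} {k : SIsothermicNet (I ×ˢ J)}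
    (hc : c.IsIsothermic) (hck : c.HasKoebeDual k) : ∃ σ : ℤˣ, k.IsAssocNullCongruence σ 0 c := by
  obtain ⟨hk, h, hh, hd⟩ := hck
  have hline := fun {f} (hf : f ∈ I ×ˢ J) => line_of_isIsothermic hc hk hh hd hf
  have hsign : ∃ σ, ∀ f ∈ I ×ˢ J, c.HasSign k f σ := by
    by_cases hne : (I ×ˢ J).Nonempty
    · obtain ⟨f₀, hf₀⟩ := hne
      obtain ⟨σ, hσ⟩ := (hline hf₀).2
      refine ⟨σ, fun f hf => face_induction hI hJ (P := fun f => c.HasSign k f σ) ?_ hf₀ hf hσ⟩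
      intro f hf f' hf' w b e hs
      obtain ⟨σ', hσ'⟩ := (hline hf').2
      rwa [hs.eq_of_sharedEdge hk hd hf hf' e (hline hf).1 (hline hf').1 hσ']
    · exact ⟨1, fun f hf => (hne ⟨f, hf⟩).elim⟩
  obtain ⟨σ, hσ⟩ := hsign
  have hcenter : ∀ f ∈ I ×ˢ J, ∀ w, IsWhite w → Incident w f → (c.sphere w).center =
      h.pt f - (edgeSign w f * (k.sphere w).radius⁻¹) • (k.sphere w).normal (k.pt f) := by
    intro f hf w hw hwf
    have hR := k.timelike w ⟨f, hf, hwf⟩ hw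
    have h1 := hd.sphere_center hf hw hwf
    rw [hh w ⟨f, hf, hwf⟩ hw, sub_eq_iff_eq_add] at h1
    rw [h1, OrientedSphere.normal]
    match_scalars <;> field_simp
  -- At angle zero the radius correction vanishes, so `c` serves as its own associated contact
  -- congruence.
  refine ⟨σ, c.toContactCongruence, ⟨fun w => (c.sphere w).center, ?_, ?_, ?_⟩,
    fun v _ => ⟨rfl, by simp⟩⟩
  · intro f hf w w' hw hw' hwf hwf'
    change (c.sphere w').center - (c.sphere w).center = _
    rw [SIsothermicNet.assocTangent, lorentzRotation_zero, hcenter f hf w hw hwf,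
      hcenter f hf w' hw' hwf', k.normal_eq hf hw' hw hwf' hwf,
      edgeSign_eq_of_white hw hw' hwf hwf']
    module
  · intro w hv hw
    rw [hd.2.2 w hv hw, inv_inv, hh w hv hw]
  · intro f hf w hw hwf
    refine ⟨?_, ?_⟩
    · rw [SIsothermicNet.assocPt, SIsothermicNet.assocTangent, lorentzRotation_zero,
        hcenter f hf w hw hwf, sub_add_cancel]
      exact (hline hf).1
    · obtain ⟨t, ht⟩ := hσ f hf
      refine ⟨t, ?_⟩
      rw [SIsothermicNet.assocBinormal, lorentzRotation_zero]
      exact ht w hw hwf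

end NullCongruence

/-! ### Existence of the associated null congruences -/

theorem IsBlack.not_isWhite {b : ℤ × ℤ} (hb : IsBlack b) : ¬ IsWhite b :=
  Int.not_odd_iff_even.mpr hb

theorem isBlack_of_not_isWhite {b : ℤ × ℤ} (hb : ¬ IsWhite b) : IsBlack b :=
  Int.not_odd_iff_even.mp hb

/-- The sphere enters only through `T`, so any white corner of the face may be used to define the
edge to a black vertex. -/
theorem KoebeCorner.circleEdge_congr {N M M' C : LorentzSpace} {R R' : ℝ}
    (hT : R⁻¹ • (N - M) = R'⁻¹ • (N - M')) (r s σ φ : ℝ) :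
    circleEdge N M C R r s σ φ = circleEdge N M' C R' r s σ φ := by
  rw [circleEdge, circleEdge, offset, offset, hT]

/-- Decreasing all radii of a contact congruence, whose spheres at black vertices have the
constant radius `δ`, by `δ`. -/
def ContactCongruence.toNull {D : Set (ℤ × ℤ)} (g : ContactCongruence D) (δ : ℝ)
    (hb : ∀ b, IsVertex D b → IsBlack b → (g.sphere b).radius = δ)
    (hw : ∀ w, IsVertex D w → IsWhite w → (g.sphere w).radius ≠ δ) : NullCongruence D where
  sphere v := ⟨(g.sphere v).center, (g.sphere v).radius - δ⟩
  line f := (g.line f).shift δ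
  contact f hf v hv := (g.contact f hf v hv).shift δ
  black_null b hv hbb := sub_eq_zero.mpr (hb b hv hbb)
  white_timelike w hv hww := sub_ne_zero.mpr (hw w hv hww)

namespace SIsothermicNet

/-- Vertex centers and contact points are integrated together from `sphereEdge` and `circleEdge`.
The line `L₀` is only a filler at faces outside the domain. -/
theorem exists_isAssocCongruence {I J : Set ℤ} (hJ : J.OrdConnected)
    {h k : SIsothermicNet (I ×ˢ J)} (hk : k.IsKoebe) (hd : h.IsChristoffelDual k)
    (L₀ : OrientedIsotropicLine) (σ : ℤˣ) (φ : ℝ) :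
    ∃ g : ContactCongruence (I ×ˢ J), k.IsAssocCongruence σ φ g ∧
      (∀ b, IsBlack b → (g.sphere b).radius = ((σ : ℤ) : ℝ) * Real.sin φ) ∧
      ∀ w, IsWhite w → (g.sphere w).radius = (k.sphere w).radius⁻¹ := by
  classical
  have hσ := units_sq_real σ
  generalize hσ' : ((σ : ℤ) : ℝ) = σ' at hσ
  choose wf hwf hwf' using exists_white
  let S : ℤ × ℤ → ℤ × ℤ → LorentzSpace := fun v f =>
    if IsWhite v then
      KoebeCorner.sphereEdge (k.pt f) (k.sphere v).center (k.sphere v).radius (edgeSign v f) φ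
    else
      KoebeCorner.circleEdge (k.pt f) (k.sphere (wf f)).center (k.circle v).center
        (k.sphere (wf f)).radius (k.circle v).radius (edgeSign v f) σ' φ
  have hSw : ∀ w f, IsWhite w → S w f =
      KoebeCorner.sphereEdge (k.pt f) (k.sphere w).center (k.sphere w).radius (edgeSign w f) φ :=
    fun w f hw => if_pos hw
  have hSb : ∀ b f w, f ∈ I ×ˢ J → IsBlack b → IsWhite w → Incident w f → S b f =
      KoebeCorner.circleEdge (k.pt f) (k.sphere w).center (k.circle b).center
        (k.sphere w).radius (k.circle b).radius (edgeSign b f) σ' φ :=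
    fun b f w hf hb hw hwi => (if_neg hb.not_isWhite).trans
      (KoebeCorner.circleEdge_congr (k.normal_eq hf (hwf f) hw (hwf' f) hwi) _ _ _ _)
  obtain ⟨Z, K, hZ⟩ := exists_vertex_face_potential (I := I) hJ S (by
    intro f hf f' hf' w b e
    rw [hSw w f e.white, hSw w f' e.white, hSb b f w hf e.black e.white e.white_left,
      hSb b f' w hf' e.black e.white e.white_right,
      edgeSign_black e.white e.black e.white_left e.black_left,
      edgeSign_black e.white e.black e.white_right e.black_right, e.edgeSign_right, neg_neg]
    exact (hd.isKite hf hf' e).closed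
      (hk.koebeCorner hf e.white e.black e.white_left e.black_left) _ _ _)
  have hL : ∀ f, ∃ L : OrientedIsotropicLine, f ∈ I ×ˢ J → K f ∈ L.points ∧ ∃ t : ℝ, t ≠ 0 ∧
      L.dir = t • (k.pt f + σ' • k.assocBinormal φ (wf f) f) ∧
      L.dir 2 = σ' * edgeSign (wf f) f := by
    intro f
    by_cases hf : f ∈ I ×ˢ J
    · have hF := hk.isFrame hf (hwf f) (hwf' f)
      have hF' := hF.rotation φ
      have hE : k.assocBinormal φ (wf f) f = _ := (hF.cross_rotation_tangent φ).symm
      -- The sign of the third coordinate is the orientation for which the signed distance of the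
      -- white center is `+1/R`.
      obtain ⟨L, t, h1, h2, h3⟩ := exists_isotropicLine (K f) (hF'.inner_isotropic hσ)
        (hF'.isotropic_ne_zero σ') (a := σ' * edgeSign (wf f) f)
        (by rw [mul_pow, hσ, edgeSign_sq, one_mul])
      rw [← hE] at h2
      refine ⟨L, fun _ => ⟨h1, t, ?_, h2, h3⟩⟩
      rintro rfl
      exact L.dir_ne_zero (by rw [h2, zero_smul])
    · exact ⟨L₀, fun h => (hf h).elim⟩
  choose L hL using hL
  have hB : ∀ f ∈ I ×ˢ J, ∀ w, IsWhite w → Incident w f →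
      k.assocBinormal φ (wf f) f = k.assocBinormal φ w f := by
    intro f hf w hw hwi
    rw [assocBinormal, assocBinormal, k.normal_eq hf (hwf f) hw (hwf' f) hwi]
  let sph : ℤ × ℤ → OrientedSphere := fun v =>
    if IsWhite v then ⟨Z v, (k.sphere v).radius⁻¹⟩ else ⟨Z v, σ' * Real.sin φ⟩
  have hsw : ∀ w, IsWhite w → sph w = ⟨Z w, (k.sphere w).radius⁻¹⟩ := fun w hw => if_pos hw
  have hsb : ∀ b, IsBlack b → sph b = ⟨Z b, σ' * Real.sin φ⟩ := fun b hb => if_neg hb.not_isWhite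
  refine ⟨⟨sph, L, ?_⟩, ⟨Z, ?_, ?_, ?_⟩, ?_, ?_⟩
  · intro f hf v hv
    obtain ⟨hK, t, ht, hdir, hdir2⟩ := hL f hf
    have hs := edgeSign_sq (wf f) f
    by_cases hvw : IsWhite v
    · obtain ⟨b, hb, hbi⟩ := exists_black f
      rw [hB f hf v hvw hv] at hdir
      rw [edgeSign_eq_of_white hvw (hwf f) hv (hwf' f)] at hs hdir2
      change (sph v).ContactLine (L f)
      rw [hsw v hvw, hZ f hf v hv, hSw v f hvw]
      exact (hk.koebeCorner hf hvw hb hv hbi).contactLine_sphere hσ hs ht hdir hdir2 hK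
    · have hvb := isBlack_of_not_isWhite hvw
      change (sph v).ContactLine (L f)
      rw [hsb v hvb, hZ f hf v hv, hSb v f (wf f) hf hvb (hwf f) (hwf' f),
        edgeSign_black (hwf f) hvb (hwf' f) hv]
      exact (hk.koebeCorner hf (hwf f) hvb (hwf' f) hv).contactLine_circle hσ hs ht hdir hdir2 hK
  · intro f hf w w' hw hw' hwi hwi'
    obtain ⟨b, hb, hbi⟩ := exists_black f
    rw [hZ f hf w hwi, hZ f hf w' hwi', hSw w f hw, hSw w' f hw',
      (hk.koebeCorner hf hw hb hwi hbi).sphereEdge_eq,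
      (hk.koebeCorner hf hw' hb hwi' hbi).sphereEdge_eq, assocTangent,
      edgeSign_eq_of_white hw hw' hwi hwi']
    change K f + -(_ * _) • lorentzRotation φ (k.pt f) ((k.sphere w').normal (k.pt f)) -
      (K f + -(_ * _) • lorentzRotation φ (k.pt f) ((k.sphere w).normal (k.pt f))) = _
    rw [k.normal_eq hf hw' hw hwi' hwi]
    module
  · exact fun w _ hw => hsw w hw
  · intro f hf w hw hwi
    obtain ⟨hK, t, ht, hdir, hdir2⟩ := hL f hf
    obtain ⟨b, hb, hbi⟩ := exists_black f
    refine ⟨?_, t, by rw [hσ', ← hB f hf w hw hwi]; exact hdir⟩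
    have : k.assocPt φ Z w f = K f := by
      rw [assocPt, hZ f hf w hwi, hSw w f hw, (hk.koebeCorner hf hw hb hwi hbi).sphereEdge_eq,
        assocTangent]
      change K f + -(_ * _) • lorentzRotation φ (k.pt f) ((k.sphere w).normal (k.pt f)) + _ = _
      module
    rw [this]
    exact hK
  · intro b hb
    change (sph b).radius = _
    rw [hsb b hb]
  · intro w hw
    change (sph w).radius = _
    rw [hsw w hw]

theorem exists_isAssocNullCongruence {I J : Set ℤ} (hJ : J.OrdConnected)
    {c : NullCongruence (I ×ˢ J)} {k : SIsothermicNet (I ×ˢ J)} (hck : c.HasKoebeDual k)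
    (σ : ℤˣ) (φ : ℝ) (hφ : ∀ w, IsVertex (I ×ˢ J) w → IsWhite w →
      (c.sphere w).radius ≠ ((σ : ℤ) : ℝ) * Real.sin φ) :
    ∃ c' : NullCongruence (I ×ˢ J), k.IsAssocNullCongruence σ φ c' := by
  obtain ⟨hk, h, hh, hd⟩ := hck
  obtain ⟨g, hg, hb, hw⟩ := exists_isAssocCongruence hJ hk hd (c.line 0) σ φ
  refine ⟨g.toNull _ (fun b _ => hb b) (fun w hv hww => ?_), g, hg, fun v _ => ⟨rfl, rfl⟩⟩
  rw [hw w hww, hd.2.2 w hv hww, inv_inv, hh w hv hww]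
  exact hφ w hv hww

end SIsothermicNet

/-! ### The X-variables of the associated family -/

/-- The difference or sum of the projections of two isotropic directions. -/
theorem OrientedIsotropicLine.toPlane_dir_sq (L L' : OrientedIsotropicLine) {a : ℝ}
    (ha : L.dir 2 * L'.dir 2 = a) (ha2 : a ^ 2 = 1) :
    (toPlane L.dir - a * toPlane L'.dir) ^ 2 =
      toPlane L.dir * toPlane L'.dir * (2 * lorentzInner L.dir L'.dir : ℝ) := by
  have h := L.planar_unit
  have h' := L'.planar_unit
  have e : lorentzInner L.dir L'.dir = L.dir 0 * L'.dir 0 + L.dir 1 * L'.dir 1 - a := by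
    rw [lorentzInner, ha]
  have hd : toPlane L.dir = L.dir 0 + L.dir 1 * Complex.I := Complex.mk_eq_add_mul_I _ _
  have hd' : toPlane L'.dir = L'.dir 0 + L'.dir 1 * Complex.I := Complex.mk_eq_add_mul_I _ _
  have hc : (L.dir 0 : ℂ) ^ 2 + (L.dir 1 : ℂ) ^ 2 = 1 := by exact_mod_cast h
  have hc' : (L'.dir 0 : ℂ) ^ 2 + (L'.dir 1 : ℂ) ^ 2 = 1 := by exact_mod_cast h'
  have hac : (a : ℂ) ^ 2 = 1 := by exact_mod_cast ha2
  have hI := Complex.I_sq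
  rw [e, hd, hd']
  push_cast
  generalize (L.dir 0 : ℂ) = x at *
  generalize (L.dir 1 : ℂ) = y at *
  generalize (L'.dir 0 : ℂ) = x' at *
  generalize (L'.dir 1 : ℂ) = y' at *
  generalize Complex.I = i at *
  linear_combination (x' + y' * i) ^ 2 * hac - (x + y * i) ^ 2 * hc' - (x' + y' * i) ^ 2 * hc +
    ((x + y * i) * y' - (x' + y' * i) * y) ^ 2 * hI

theorem OrientedIsotropicLine.toPlane_dir_ne_zero (L : OrientedIsotropicLine) :
    toPlane L.dir ≠ 0 := by
  intro h
  have := L.dir_unit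
  rw [h, norm_zero] at this
  exact zero_ne_one this

/-- The position, relative to the center of a circle of radius `ρ`, of the intersection point of
two tangent lines. -/
theorem OrientedIsotropicLine.toPlane_mul_add (L L' : OrientedIsotropicLine) {x : LorentzSpace}
    {ρ : ℝ} (hx : lorentzInner x L.dir = 0) (hx' : lorentzInner x L'.dir = 0)
    (hρ : planarDet L.dir x = ρ) (hρ' : planarDet L'.dir x = ρ) (h2 : L'.dir 2 = -L.dir 2) :
    toPlane x * (toPlane L.dir + toPlane L'.dir) =
      2 * ρ * Complex.I * toPlane L.dir * toPlane L'.dir := by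
  have e : ∀ (L : OrientedIsotropicLine), lorentzInner x L.dir = 0 → planarDet L.dir x = ρ →
      toPlane x = toPlane L.dir * ((x 2 * L.dir 2 : ℝ) + ρ * Complex.I) := by
    intro L hx hρ
    have h := L.planar_unit
    simp only [lorentzInner] at hx
    simp only [planarDet] at hρ
    apply Complex.ext <;> simp [toPlane]
    · linear_combination (-x 0) * h + L.dir 0 * hx - L.dir 1 * hρ
    · linear_combination (-x 1) * h + L.dir 1 * hx + L.dir 0 * hρ
  have e1 := e L hx hρ
  have e2 := e L' hx' hρ'
  rw [h2] at e2
  push_cast at e1 e2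
  linear_combination toPlane L'.dir * e1 + toPlane L.dir * e2

/-- A cross-ratio is determined by the squares of the factors, which are proportional to the
numbers `n₁₂`, …, up to factors that cancel. -/
theorem crossRatio_eq {d₁ d₂ d₃ d₄ t₁ t₂ t₃ t₄ κ n₁₂ n₂₃ n₃₄ n₄₁ n₁₃ n₂₄ : ℂ}
    (h₁₂ : d₁ + d₂ ≠ 0) (h₃₄ : d₃ + d₄ ≠ 0)
    (e₁₂ : (d₁ + d₂) ^ 2 = d₁ * d₂ * (t₁ * t₂ * κ * n₁₂))
    (e₂₃ : (d₂ + d₃) ^ 2 = d₂ * d₃ * (t₂ * t₃ * κ * n₂₃))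
    (e₃₄ : (d₃ + d₄) ^ 2 = d₃ * d₄ * (t₃ * t₄ * κ * n₃₄))
    (e₄₁ : (d₄ + d₁) ^ 2 = d₄ * d₁ * (t₄ * t₁ * κ * n₄₁))
    (e₁₃ : (d₁ - d₃) ^ 2 = d₁ * d₃ * (t₁ * t₃ * κ * n₁₃))
    (e₂₄ : (d₂ - d₄) ^ 2 = d₂ * d₄ * (t₂ * t₄ * κ * n₂₄)) :
    -(((d₂ + d₃) * (d₄ + d₁)) / ((d₁ + d₂) * (d₃ + d₄))) =
      (n₁₃ * n₂₄ - n₂₃ * n₄₁ - n₁₂ * n₃₄) / (2 * (n₁₂ * n₃₄)) := by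
  set A := (d₁ + d₂) * (d₃ + d₄) with hA
  set B := (d₂ + d₃) * (d₄ + d₁) with hB
  set u := d₁ * d₂ * d₃ * d₄ * (t₁ * t₂ * t₃ * t₄) * κ ^ 2 with hu
  have hA0 : A ≠ 0 := mul_ne_zero h₁₂ h₃₄
  have hAA : A ^ 2 = u * (n₁₂ * n₃₄) := by rw [hA, mul_pow, e₁₂, e₃₄, hu]; ring
  have hBB : B ^ 2 = u * (n₂₃ * n₄₁) := by rw [hB, mul_pow, e₂₃, e₄₁, hu]; ring
  have hCC : (A - B) ^ 2 = u * (n₁₃ * n₂₄) := by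
    -- This Ptolemy-type identity turns the squares of `A`, `B` and `A - B` into the product `A *
    -- B`, so no square root has to be chosen.
    have : A - B = -((d₁ - d₃) * (d₂ - d₄)) := by rw [hA, hB]; ring
    rw [this, neg_sq, mul_pow, e₁₃, e₂₄, hu]; ring
  have hne : u * (n₁₂ * n₃₄) ≠ 0 := by rw [← hAA]; exact pow_ne_zero 2 hA0
  have hu0 : u ≠ 0 := left_ne_zero_of_mul hne
  have hn0 : n₁₂ * n₃₄ ≠ 0 := right_ne_zero_of_mul hne
  have hm : n₁₃ * n₂₄ - n₂₃ * n₄₁ - n₁₂ * n₃₄ = -(2 * A * B) / u := by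
    rw [eq_div_iff hu0]; linear_combination -hCC + hBB + hAA
  have hm' : n₁₂ * n₃₄ = A ^ 2 / u := by rw [eq_div_iff hu0]; linear_combination -hAA
  rw [hm, hm']
  field_simp

namespace SIsothermicNet

variable {D : Set (ℤ × ℤ)} {k : SIsothermicNet D}

/-- The X-variable of all members of the associated family at a white vertex. -/
noncomputable def assocXVar (k : SIsothermicNet D) (w : ℤ × ℤ) : ℂ :=
  let n : ℤ × ℤ → ℤ × ℤ → ℂ := fun f f' => (lorentzSq (k.pt f - k.pt f') : ℝ)
  let f₁ := (w.1, w.2 - 1)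
  let f₂ := (w.1, w.2)
  let f₃ := (w.1 - 1, w.2)
  let f₄ := (w.1 - 1, w.2 - 1)
  (n f₁ f₃ * n f₂ f₄ - n f₂ f₃ * n f₄ f₁ - n f₁ f₂ * n f₃ f₄) / (2 * (n f₁ f₂ * n f₃ f₄))

/-- The computation uses the lines of `g` instead of those of `c`: the centers agree, and relative
to the center at `w` both families are tangent to concentric circles, so the points `b` are given by
the tangent formula with radius `σ sin φ - 1/R`. -/
theorem IsAssocNullCongruence.xVar_eq (hk : k.IsKoebe) {σ : ℤˣ} {φ : ℝ} {c : NullCongruence D}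
    (hc : k.IsAssocNullCongruence σ φ c) (w : ℤ × ℤ) (hw : IsWhite w) (hD : IsInterior D w) :
    c.xVar w hw hD = k.assocXVar w := by
  obtain ⟨g, ⟨P, -, hPw, hline⟩, hrad⟩ := hc
  have hσ := units_sq_real σ
  generalize ((σ : ℤ) : ℝ) = σ' at *
  have hv : IsVertex D w := (hD.white hw).1
  have hR := k.timelike w hv hw
  obtain ⟨hcw, hrw⟩ := hrad w hv
  have hρ := c.white_timelike w hv hw
  rw [hrw, hPw w hv hw] at hρ
  rw [hPw w hv hw] at hcw
  change (k.sphere w).radius⁻¹ - σ' * Real.sin φ ≠ 0 at hρ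
  change (c.sphere w).center = P w at hcw
  have hface : ∀ f, Incident w f → ∃ t : ℝ,
      (g.line f).dir = t • (k.pt f + σ' • k.assocBinormal φ w f) ∧
      (g.line f).dir 2 = σ' * edgeSign w f ∧
      lorentzInner (P w - k.assocPt φ P w f) (g.line f).dir = 0 ∧
      planarDet (g.line f).dir (P w - k.assocPt φ P w f) = (k.sphere w).radius⁻¹ ∧
      k.assocPt φ P w f ∈ (g.line f).points := by
    intro f hwf
    obtain ⟨hK, t, ht⟩ := hline f (hD f hwf) w hw hwf
    have hF := hk.isFrame (hD f hwf) hw hwf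
    have h1 := (OrientedSphere.contactLine_iff hK).mp (g.contact f (hD f hwf) w hwf)
    rw [hPw w hv hw] at h1
    obtain ⟨h1, h2⟩ := h1
    change lorentzInner (P w - k.assocPt φ P w f) (g.line f).dir = 0 at h1
    change planarDet (g.line f).dir (P w - k.assocPt φ P w f) = (k.sphere w).radius⁻¹ at h2
    refine ⟨t, ht, ?_, h1, h2, hK⟩
    have ht0 : t ≠ 0 := by
      rintro rfl
      exact (g.line f).dir_ne_zero (by rw [ht, zero_smul])
    have hs := edgeSign_sq w f
    have e : P w - k.assocPt φ P w f =
        -(edgeSign w f * (k.sphere w).radius⁻¹) • lorentzRotation φ (k.pt f)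
          ((k.sphere w).normal (k.pt f)) := by
      rw [assocPt, assocTangent]; module
    have hT := (hF.rotation φ).unit
    rw [assocBinormal, ← hF.cross_rotation_tangent] at ht
    rw [(hF.rotation φ).planarDet_eq hσ ht0 ht h1, e, lorentzInner_smul_left, hT] at h2
    -- Oriented contact with the white sphere determines the third coordinate, and with it the
    -- orientation of the line.
    have h3 : σ' * edgeSign w f * (g.line f).dir 2 = 1 := by
      apply mul_left_cancel₀ (inv_ne_zero hR)
      linear_combination h2
    linear_combination (σ' * edgeSign w f) * h3 - (g.line f).dir 2 * edgeSign w f ^ 2 * hσ -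
      (g.line f).dir 2 * hs
  choose t hdir hthird hperp hdet hK using hface
  have hblack : ∀ b f, ∀ hwf : Incident w f, IsBlack b → Incident b f →
      lorentzInner ((c.sphere b).center - (c.sphere w).center) (g.line f).dir = 0 ∧
      planarDet (g.line f).dir ((c.sphere b).center - (c.sphere w).center) =
        σ' * Real.sin φ - (k.sphere w).radius⁻¹ := by
    intro b f hwf hb hbf
    have hbv : IsVertex D b := ⟨f, hD f hwf, hbf⟩
    obtain ⟨h1, h2⟩ := hrad b hbv
    -- Since `c` has null-spheres at black vertices, the black spheres of `g` must have radius `σ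
    -- sin φ`.
    rw [c.black_null b hbv hb] at h2
    obtain ⟨h3, h4⟩ :=
      (OrientedSphere.contactLine_iff (hK f hwf)).mp (g.contact f (hD f hwf) b hbf)
    rw [hcw, h1, ← sub_sub_sub_cancel_right _ _ (k.assocPt φ P w f), lorentzInner_sub_left,
      planarDet_sub, h3, h4, hperp f hwf, hdet f hwf]
    exact ⟨sub_zero _, by linarith⟩
  have htan : ∀ b f f', SharedEdge f f' w b →
      toPlane (g.line f).dir + toPlane (g.line f').dir ≠ 0 ∧
      (toPlane (c.sphere b).center - toPlane (c.sphere w).center) =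
        2 * (σ' * Real.sin φ - (k.sphere w).radius⁻¹ : ℝ) * Complex.I *
          toPlane (g.line f).dir * toPlane (g.line f').dir /
          (toPlane (g.line f).dir + toPlane (g.line f').dir) := by
    intro b f f' e
    obtain ⟨h1, h2⟩ := hblack b f e.white_left e.black e.black_left
    obtain ⟨h3, h4⟩ := hblack b f' e.white_right e.black e.black_right
    have h5 := (g.line f).toPlane_mul_add (g.line f') h1 h3 h2 h4
      (by rw [hthird f e.white_left, hthird f' e.white_right, e.edgeSign_right]; ring)
    have h6 : toPlane ((c.sphere b).center - (c.sphere w).center) =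
        toPlane (c.sphere b).center - toPlane (c.sphere w).center := by
      apply Complex.ext <;> simp [toPlane]
    -- Antiparallel tangents would make the right-hand side of the tangent formula zero, contrary to
    -- the non-zero radius of the white sphere of `c`.
    have hne : toPlane (g.line f).dir + toPlane (g.line f').dir ≠ 0 := by
      intro h0
      rw [h0, mul_zero] at h5
      have h7 : ((σ' * Real.sin φ - (k.sphere w).radius⁻¹ : ℝ) : ℂ) ≠ 0 := by
        rw [Complex.ofReal_ne_zero, ← neg_ne_zero, neg_sub]
        exact hρ
      exact mul_ne_zero (mul_ne_zero (mul_ne_zero (mul_ne_zero two_ne_zero h7) Complex.I_ne_zero)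
        (g.line f).toPlane_dir_ne_zero) (g.line f').toPlane_dir_ne_zero h5.symm
    exact ⟨hne, by rw [eq_div_iff hne, ← h6, h5]⟩
  have hinner : ∀ f f', ∀ hf : Incident w f, ∀ hf' : Incident w f',
      2 * lorentzInner (g.line f).dir (g.line f').dir = t f hf * t f' hf' *
        (-((k.sphere w).radius⁻¹ - σ' * Real.sin φ) ^ 2) * lorentzSq (k.pt f - k.pt f') := by
    intro f f' hf hf'
    obtain ⟨b, hb, hbf⟩ := exists_black f
    obtain ⟨b', hb', hbf'⟩ := exists_black f'
    have h1 := (hk.koebeCorner (hD f hf) hw hb hf hbf).inner_isotropic_isotropic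
      (hk.koebeCorner (hD f' hf') hw hb' hf' hbf') (φ := φ) hσ
    rw [hdir f hf, hdir f' hf', lorentzInner_smul_left, lorentzInner_smul_right, lorentzSq]
    change lorentzInner (k.pt f + σ' • k.assocBinormal φ w f)
      (k.pt f' + σ' • k.assocBinormal φ w f') = _ at h1
    rw [h1]
    ring
  have hsum : ∀ f f', ∀ hf : Incident w f, ∀ hf' : Incident w f', edgeSign w f' = -edgeSign w f →
      (toPlane (g.line f).dir + toPlane (g.line f').dir) ^ 2 =
        toPlane (g.line f).dir * toPlane (g.line f').dir * (t f hf * t f' hf' *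
          (-((k.sphere w).radius⁻¹ - σ' * Real.sin φ) ^ 2 : ℝ) *
            (lorentzSq (k.pt f - k.pt f') : ℝ)) := by
    intro f f' hf hf' hs
    have h1 := (g.line f).toPlane_dir_sq (g.line f') (a := -1) (by
      rw [hthird f hf, hthird f' hf', hs]
      linear_combination -(edgeSign w f ^ 2) * hσ - edgeSign_sq w f) (by norm_num)
    rw [hinner f f' hf hf'] at h1
    push_cast at h1 ⊢
    linear_combination h1
  have hsub : ∀ f f', ∀ hf : Incident w f, ∀ hf' : Incident w f', edgeSign w f' = edgeSign w f →
      (toPlane (g.line f).dir - toPlane (g.line f').dir) ^ 2 =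
        toPlane (g.line f).dir * toPlane (g.line f').dir * (t f hf * t f' hf' *
          (-((k.sphere w).radius⁻¹ - σ' * Real.sin φ) ^ 2 : ℝ) *
            (lorentzSq (k.pt f - k.pt f') : ℝ)) := by
    intro f f' hf hf' hs
    have h1 := (g.line f).toPlane_dir_sq (g.line f') (a := 1) (by
      rw [hthird f hf, hthird f' hf', hs]
      linear_combination (edgeSign w f ^ 2) * hσ + edgeSign_sq w f) (by norm_num)
    rw [hinner f f' hf hf'] at h1
    push_cast at h1 ⊢
    linear_combination h1
  have i₁ : Incident w (w.1, w.2 - 1) := by simp [Incident]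
  have i₂ : Incident w (w.1, w.2) := by simp [Incident]
  have i₃ : Incident w (w.1 - 1, w.2) := by simp [Incident]
  have i₄ : Incident w (w.1 - 1, w.2 - 1) := by simp [Incident]
  have s₁ : SharedEdge (w.1, w.2 - 1) (w.1, w.2) w (w.1 + 1, w.2) :=
    ⟨by rw [Ne, Prod.ext_iff]; dsimp only; omega, hw, (hD.east hw).2, i₁, i₂, by simp [Incident], by simp [Incident]⟩
  have s₂ : SharedEdge (w.1, w.2) (w.1 - 1, w.2) w (w.1, w.2 + 1) :=
    ⟨by rw [Ne, Prod.ext_iff]; dsimp only; omega, hw, (hD.north hw).2, i₂, i₃, by simp [Incident], by simp [Incident]⟩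
  have s₃ : SharedEdge (w.1 - 1, w.2) (w.1 - 1, w.2 - 1) w (w.1 - 1, w.2) :=
    ⟨by rw [Ne, Prod.ext_iff]; dsimp only; omega, hw, (hD.west hw).2, i₃, i₄, by simp [Incident], by simp [Incident]⟩
  have s₄ : SharedEdge (w.1 - 1, w.2 - 1) (w.1, w.2 - 1) w (w.1, w.2 - 1) :=
    ⟨by rw [Ne, Prod.ext_iff]; dsimp only; omega, hw, (hD.south hw).2, i₄, i₁, by simp [Incident], by simp [Incident]⟩
  obtain ⟨a₁, b₁⟩ := htan _ _ _ s₁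
  obtain ⟨a₂, b₂⟩ := htan _ _ _ s₂
  obtain ⟨a₃, b₃⟩ := htan _ _ _ s₃
  obtain ⟨a₄, b₄⟩ := htan _ _ _ s₄
  have key := crossRatio_eq a₁ a₃ (hsum _ _ i₁ i₂ s₁.edgeSign_right)
    (hsum _ _ i₂ i₃ s₂.edgeSign_right) (hsum _ _ i₃ i₄ s₃.edgeSign_right)
    (hsum _ _ i₄ i₁ s₄.edgeSign_right)
    (hsub _ _ i₁ i₃ (by rw [s₂.edgeSign_right, s₁.edgeSign_right, neg_neg]))
    (hsub _ _ i₂ i₄ (by rw [s₃.edgeSign_right, s₂.edgeSign_right, neg_neg]))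
  refine Eq.trans ?_ key
  change -(((toPlane (c.sphere (w.1 + 1, w.2)).center - toPlane (c.sphere w).center) *
    (toPlane (c.sphere (w.1 - 1, w.2)).center - toPlane (c.sphere w).center)) /
    ((toPlane (c.sphere (w.1, w.2 + 1)).center - toPlane (c.sphere w).center) *
    (toPlane (c.sphere (w.1, w.2 - 1)).center - toPlane (c.sphere w).center))) = _
  rw [b₁, b₂, b₃, b₄]
  have h7 : ((σ' * Real.sin φ - (k.sphere w).radius⁻¹ : ℝ) : ℂ) ≠ 0 := by
    rw [Complex.ofReal_ne_zero, ← neg_ne_zero, neg_sub]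
    exact hρ
  have n₁ := (g.line (w.1, w.2 - 1)).toPlane_dir_ne_zero
  have n₂ := (g.line (w.1, w.2)).toPlane_dir_ne_zero
  have n₃ := (g.line (w.1 - 1, w.2)).toPlane_dir_ne_zero
  have n₄ := (g.line (w.1 - 1, w.2 - 1)).toPlane_dir_ne_zero
  have hI := Complex.I_ne_zero
  generalize ((σ' * Real.sin φ - (k.sphere w).radius⁻¹ : ℝ) : ℂ) = r at *
  generalize toPlane (g.line (w.1, w.2 - 1)).dir = d₁ at *
  generalize toPlane (g.line (w.1, w.2)).dir = d₂ at *
  generalize toPlane (g.line (w.1 - 1, w.2)).dir = d₃ at *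
  generalize toPlane (g.line (w.1 - 1, w.2 - 1)).dir = d₄ at *
  generalize Complex.I = i at *
  field_simp

end SIsothermicNet

theorem mainTheorem1 (I J : Set ℤ) (hI : I.OrdConnected) (hJ : J.OrdConnected)
    (c : NullCongruence (I ×ˢ J)) (hc : c.IsMaximal) :
    ∀ k : SIsothermicNet (I ×ˢ J), c.HasKoebeDual k →
      (∃ σ : ℤˣ, k.IsAssocNullCongruence σ 0 c) ∧
      (∀ (σ : ℤˣ) (φ : ℝ),
        (∀ w, IsVertex (I ×ˢ J) w → IsWhite w →
          (c.sphere w).radius ≠ ((σ : ℤ) : ℝ) * Real.sin φ) →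
        ∃ c' : NullCongruence (I ×ˢ J), k.IsAssocNullCongruence σ φ c') ∧
      (∀ (σ : ℤˣ) (φ : ℝ) (c' : NullCongruence (I ×ˢ J)), k.IsAssocNullCongruence σ φ c' →
        ∀ (w : ℤ × ℤ) (hw : IsWhite w) (hD : IsInterior (I ×ˢ J) w),
          c'.xVar w hw hD = c.xVar w hw hD) := by
  intro k hk
  have h1 := NullCongruence.exists_isAssocNullCongruence_zero hI hJ hc.1 hk
  refine ⟨h1, fun σ φ hφ => SIsothermicNet.exists_isAssocNullCongruence hJ hk σ φ hφ, ?_⟩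
  intro σ φ c' hc' w hw hD
  obtain ⟨σ₀, h₀⟩ := h1
  rw [hc'.xVar_eq hk.1, h₀.xVar_eq hk.1]
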